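/- Let $X_n$ and $P_n$, $n\ge 1$, be $n\times n$ random matrices defined on one probability space, either all real symmetric or all complex Hermitian. (As $P_n$ has rank $r$, only $n\ge r$ matters for $P_n$.) Write $\lambda_1(M)\ge\cdots\ge\lambda_n(M)$ for the ordered eigenvalues of an $n\times n$ matrix $M$ with real spectrum. Assume the following. - Every $X_n$ is nonnegative definite. Almost surely, the empirical eigenvalue distribution $\frac1n\sum_{k=1}^n\delta_{\lambda_k(X_n)}$ converges weakly, as $n\to\infty$, to a non-random compactly supported probability measure $\mu_X\ne\delta_0$ on $\mathbb R$. With $a$ and $b$ the infimum and the supremum of the support of $\mu_X$, almost surely $\lambda_n(X_n)\to a$ and $\lambda_1(X_n)\to b$. - $r\ge 1$, $0\le s\le r$, and $\theta_1\ge\cdots\ge\theta_s>0>\theta_{s+1}\ge\cdots\ge\theta_r$ are real numbers that do not depend on $n$. Every $P_n$ (with $n \ge r$) is symmetric (respectively Hermitian), of rank $r$, and its $r$ non-zero eigenvalues, counted with multiplicity, are $\theta_1,\dots,\theta_r$. - For every $n\ge r$, $X_n$ and $P_n$ are independent, and the law of at least one of $X_n$ and $P_n$ is invariant under conjugation by orthogonal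 (respectively unitary) matrices. Let $\widetilde X_n=X_n(I_n+P_n)$, and for real $z\notin\operatorname{supp}\mu_X$ let $$T_{\mu_X}(z)=\int\frac{t}{z-t}\,d\mu_X(t).$$ Let $T_{\mu_X}(b^+)=\lim_{z\downarrow b}T_{\mu_X}(z)\in(0,+\infty]$ and $T_{\mu_X}(a^-)=\lim_{z\uparrow a}T_{\mu_X}(z)\in[-\infty,0)$, with $1/\pm\infty=0$. Then all eigenvalues of $\widetilde X_n$ $(n\ge r)$ are real, $T_{\mu_X}$ maps $(b,\infty)$ bijectively onto $(0,T_{\mu_X}(b^+))$ and $(-\infty,a)$ bijectively onto $(T_{\mu_X}(a^-),0)$, and, with $T_{\mu_X}^{-1}$ denoting the inverses of these two bijections (the first at positive arguments, the second at negative arguments), the following hold as $n\to\infty$. 1. For each $1\le i\le s$, almost surely $$\lambda_i(\widetilde X_n)\longrightarrow\begin{cases}T_{\mu_X}^{-1}(1/\theta_i)&\text{if }\theta_i>1/T_{\mu_X}(b^+),\\ b&\text{otherwise.}\end{cases}$$ 2. For each fixed $i>s$, almost surely $\lambda_i(\widetilde X_n)\to b$. 3. For each $0\le j<r-s$, almost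 surely $$\lambda_{n-j}(\widetilde X_n)\longrightarrow\begin{cases}T_{\mu_X}^{-1}(1/\theta_{r-j})&\text{if }\theta_{r-j}<1/T_{\mu_X}(a^-),\\ a&\text{otherwise.}\end{cases}$$ 4. For each fixed $j\ge r-s$, almost surely $\lambda_{n-j}(\widetilde X_n)\to a$. -/

import Mathlib

open MeasureTheory ProbabilityTheory Filter Topology Set Polynomial
open scoped BoundedContinuousFunction ENNReal ComplexOrder

noncomputable section

namespace SpikedMatrix

/-- The Borel σ-algebra on matrices: the product σ-algebra of the entries. -/
instance instMeasurableSpaceMatrix (n : ℕ) (𝕜 : Type*) [RCLike 𝕜] :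
    MeasurableSpace (Matrix (Fin n) (Fin n) 𝕜) :=
  inferInstanceAs (MeasurableSpace (Fin n → Fin n → 𝕜))

/-- For a square matrix `M` all of whose eigenvalues are real, `eigenvalueDesc M k` is the `k`-th
largest eigenvalue `λ_k(M)`, `k = 1, …, n` (with multiplicity, in the characteristic polynomial),
so that `λ_1(M) ≥ ⋯ ≥ λ_n(M)`. -/
def eigenvalueDesc {𝕜 : Type*} [RCLike 𝕜] {n : ℕ} (M : Matrix (Fin n) (Fin n) 𝕜) (k : ℕ) : ℝ :=
  ((M.charpoly.roots.map RCLike.re).sort (· ≥ ·)).getD (k - 1) 0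

/-- The empirical eigenvalue distribution `(1/n) ∑_{k=1}^n δ_{λ_k(M)}`. -/
def empiricalSpectralMeasure {𝕜 : Type*} [RCLike 𝕜] {n : ℕ} (M : Matrix (Fin n) (Fin n) 𝕜) :
    Measure ℝ :=
  (n : ℝ≥0∞)⁻¹ • ∑ k ∈ Finset.Icc 1 n, Measure.dirac (eigenvalueDesc M k)

/-- Weak convergence of a sequence of measures on `ℝ`. -/
def ConvergesWeakly (ν : ℕ → Measure ℝ) (μ : Measure ℝ) : Prop :=
  ∀ f : ℝ →ᵇ ℝ, Tendsto (fun n => ∫ t, f t ∂(ν n)) atTop (𝓝 (∫ t, f t ∂μ))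

/-- The law of the random matrix `M` is invariant under conjugation by the unitary group of `𝕜^n`:
the orthogonal group if `𝕜 = ℝ`, the unitary group if `𝕜 = ℂ`. -/
def IsConjInvariant {Ω : Type*} [MeasurableSpace Ω] (Pr : Measure Ω) {𝕜 : Type*} [RCLike 𝕜] {n : ℕ}
    (M : Ω → Matrix (Fin n) (Fin n) 𝕜) : Prop :=
  ∀ U ∈ Matrix.unitaryGroup (Fin n) 𝕜, Measure.map (fun ω => U * M ω * star U) Pr = Measure.map M Pr

/-- The T-transform `T_μ(z) = ∫ t / (z - t) dμ(t)` at real points `z` outside the support. -/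
def Ttransform (μ : Measure ℝ) (z : ℝ) : ℝ := ∫ t, t / (z - t) ∂μ

/-- `T_μ(b^+)`, the limit of `T_μ(z)` as `z` decreases to `b`, in `[-∞, ∞]`. -/
def TtransformRight (μ : Measure ℝ) (b : ℝ) : EReal :=
  Function.rightLim (fun z : ℝ => (Ttransform μ z : EReal)) b

/-- `T_μ(a^-)`, the limit of `T_μ(z)` as `z` increases to `a`, in `[-∞, ∞]`. -/
def TtransformLeft (μ : Measure ℝ) (a : ℝ) : EReal :=
  Function.leftLim (fun z : ℝ => (Ttransform μ z : EReal)) a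

/-- The inverse of `T_μ` restricted to `(b, ∞)`. -/
def TinvRight (μ : Measure ℝ) (b y : ℝ) : ℝ := Function.invFunOn (Ttransform μ) (Ioi b) y

/-- The inverse of `T_μ` restricted to `(-∞, a)`. -/
def TinvLeft (μ : Measure ℝ) (a y : ℝ) : ℝ := Function.invFunOn (Ttransform μ) (Iio a) y

end SpikedMatrix

end

/-!
Writing `X = S * S` with `S` Hermitian, `X (1 + P)` has the characteristic polynomial of
`S (1 + P) S = X + (S V) Θ (S V)ᴴ`, where `P = V Θ Vᴴ` with an isometry `V` of rank `r` and `Θ`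
diagonal. By min-max, the position of the outlying eigenvalues of this Hermitian perturbation with
respect to a point `z` above the spectrum of `X` is read off the `r × r` matrix
`(S V)ᴴ (z - X)⁻¹ (S V) = Vᴴ X (z - X)⁻¹ V`. Conjugation invariance allows to average over the Haar
measure of the unitary group, where a fourth moment bound and the Borel–Cantelli lemma show that
this matrix is almost surely close to its normalised trace, whose limit is `T_μ(z)`. Hence the
eigenvalues beyond `b` converge to the solutions of `θ T_μ(z) = 1`. The smallest eigenvalues are the
largest ones of the reflected matrices `-X`.
-/

noncomputable section

namespace SpikedMatrix

open Matrix

variable {𝕜 : Type*} [RCLike 𝕜]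

lemma isHermitian_diagonal_ofReal {ι : Type*} [DecidableEq ι] (d : ι → ℝ) :
    (diagonal fun i => (d i : 𝕜)).IsHermitian :=
  isHermitian_diagonal_of_self_adjoint _ (by ext i; simp)

section QuadraticForm

variable {ι κ : Type*} [Fintype ι] [Fintype κ]

/-- The real part of the quadratic form of `M` at `x`. -/
def quadForm (M : Matrix ι ι 𝕜) (x : ι → 𝕜) : ℝ :=
  RCLike.re (star x ⬝ᵥ M *ᵥ x)

/-- The squared Euclidean norm of a vector. -/
def normSq (x : ι → 𝕜) : ℝ := ∑ i, ‖x i‖ ^ 2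

lemma normSq_nonneg (x : ι → 𝕜) : 0 ≤ normSq x :=
  Finset.sum_nonneg fun _ _ => by positivity

lemma re_star_dotProduct_self (x : ι → 𝕜) : RCLike.re (star x ⬝ᵥ x) = normSq x := by
  simp only [dotProduct, Pi.star_apply, map_sum, normSq, RCLike.star_def, RCLike.conj_mul]
  norm_cast

lemma normSq_pos {x : ι → 𝕜} (hx : x ≠ 0) : 0 < normSq x := by
  obtain ⟨i, hi⟩ := Function.ne_iff.1 hx
  exact Finset.sum_pos' (fun _ _ => by positivity)
    ⟨i, Finset.mem_univ i, by have := norm_pos_iff.2 hi; positivity⟩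

lemma quadForm_add (A B : Matrix ι ι 𝕜) (x : ι → 𝕜) :
    quadForm (A + B) x = quadForm A x + quadForm B x := by
  simp [quadForm, add_mulVec, dotProduct_add]

lemma quadForm_sub (A B : Matrix ι ι 𝕜) (x : ι → 𝕜) :
    quadForm (A - B) x = quadForm A x - quadForm B x := by
  simp [quadForm, sub_mulVec, dotProduct_sub]

lemma quadForm_neg (A : Matrix ι ι 𝕜) (x : ι → 𝕜) : quadForm (-A) x = -quadForm A x := by
  simp [quadForm, neg_mulVec]

lemma quadForm_smul (c : ℝ) (A : Matrix ι ι 𝕜) (x : ι → 𝕜) :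
    quadForm ((c : 𝕜) • A) x = c * quadForm A x := by
  rw [quadForm, smul_mulVec, dotProduct_smul, smul_eq_mul, RCLike.re_ofReal_mul, quadForm]

lemma quadForm_mulVec (M : Matrix ι ι 𝕜) (A : Matrix ι κ 𝕜) (x : κ → 𝕜) :
    quadForm M (A *ᵥ x) = quadForm (Aᴴ * M * A) x := by
  rw [quadForm, quadForm, Matrix.mul_assoc, ← mulVec_mulVec, ← mulVec_mulVec, star_mulVec,
    ← dotProduct_mulVec]

lemma normSq_mulVec (A : Matrix κ ι 𝕜) (x : ι → 𝕜) :
    normSq (A *ᵥ x) = quadForm (Aᴴ * A) x := by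
  rw [← re_star_dotProduct_self, quadForm, star_mulVec, ← dotProduct_mulVec, mulVec_mulVec]

variable [DecidableEq ι]

lemma quadForm_one (x : ι → 𝕜) : quadForm 1 x = normSq x := by
  rw [quadForm, one_mulVec, re_star_dotProduct_self]

lemma quadForm_smul_one (c : ℝ) (x : ι → 𝕜) :
    quadForm ((c : 𝕜) • (1 : Matrix ι ι 𝕜)) x = c * normSq x := by
  rw [quadForm_smul, quadForm_one]

lemma quadForm_diagonal (d : ι → ℝ) (x : ι → 𝕜) :
    quadForm (diagonal fun i => (d i : 𝕜)) x = ∑ i, d i * ‖x i‖ ^ 2 := by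
  simp only [quadForm, dotProduct, mulVec_diagonal, Pi.star_apply, map_sum, RCLike.star_def]
  refine Finset.sum_congr rfl fun i _ => ?_
  rw [mul_left_comm, RCLike.conj_mul]
  norm_cast

lemma normSq_star_mulVec {U : Matrix ι ι 𝕜} (hU : U ∈ unitaryGroup ι 𝕜) (x : ι → 𝕜) :
    normSq (star U *ᵥ x) = normSq x := by
  rw [normSq_mulVec, ← star_eq_conjTranspose, star_star, mem_unitaryGroup_iff.1 hU, quadForm_one]

lemma charpoly_unitary_conj {W : Matrix ι ι 𝕜} (hW : W ∈ unitaryGroup ι 𝕜) (M : Matrix ι ι 𝕜) :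
    (W * M * star W).charpoly = M.charpoly := by
  rw [charpoly_mul_comm, ← Matrix.mul_assoc, mem_unitaryGroup_iff'.1 hW, Matrix.one_mul]

lemma exists_unitary_diagonal_of_charpoly_eq {M : Matrix ι ι 𝕜} (hM : M.IsHermitian)
    {d : ι → ℝ} (h : M.charpoly = ∏ i, (X - C (d i : 𝕜))) :
    ∃ W ∈ unitaryGroup ι 𝕜, M = W * (diagonal fun i => (d i : 𝕜)) * star W := by
  have hN := isHermitian_diagonal_ofReal (𝕜 := 𝕜) d
  have hM' := hM.spectral_theorem
  have hN' := hN.spectral_theorem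
  rw [Unitary.conjStarAlgAut_apply] at hM' hN'
  rw [(hM.eigenvalues_eq_eigenvalues_iff hN).2 (by rw [h, charpoly_diagonal])] at hM'
  set U : Matrix ι ι 𝕜 := ↑hM.eigenvectorUnitary
  set V : Matrix ι ι 𝕜 := ↑hN.eigenvectorUnitary
  set D : Matrix ι ι 𝕜 := diagonal (RCLike.ofReal ∘ hN.eigenvalues)
  have hV : star V * V = 1 := mem_unitaryGroup_iff'.1 hN.eigenvectorUnitary.2
  refine ⟨U * star V,
    mul_mem hM.eigenvectorUnitary.2 (Unitary.star_mem hN.eigenvectorUnitary.2), ?_⟩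
  calc M = U * (star V * V) * D * (star V * V) * star U := by
        rw [hV, Matrix.mul_one, Matrix.mul_one, hM']
    _ = U * star V * (diagonal fun i => (d i : 𝕜)) * star (U * star V) := by
        rw [hN', star_mul, star_star]
        simp only [Matrix.mul_assoc]

end QuadraticForm

section Eigenvalues

variable {n k : ℕ} {M : Matrix (Fin n) (Fin n) 𝕜}

lemma eigenvalueDesc_eq_of_charpoly {f : Fin n → ℝ} (hf : Antitone f)
    (h : M.charpoly = ∏ i, (X - C (f i : 𝕜))) (i : Fin n) : eigenvalueDesc M (i + 1) = f i := by
  have hroots : M.charpoly.roots.map RCLike.re = (List.ofFn f : Multiset ℝ) := by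
    rw [h, roots_prod _ _ (by simp [Finset.prod_ne_zero_iff, X_sub_C_ne_zero])]
    simp [← Fin.univ_val_map, Multiset.bind_singleton]
  have hsort : (M.charpoly.roots.map RCLike.re).sort (· ≥ ·) = List.ofFn f := by
    rw [hroots, Multiset.coe_sort]
    apply List.mergeSort_of_pairwise
    simpa only [decide_eq_true_eq, ← List.sortedGE_iff_pairwise] using hf.sortedGE_ofFn
  simp [eigenvalueDesc, hsort, List.getD_eq_getElem?_getD]

lemma charpoly_eq_prod_eigenvalues₀ (hM : M.IsHermitian) :
    M.charpoly =
      ∏ i, (X - C (hM.eigenvalues₀ (Fin.cast (Fintype.card_fin n).symm i) : 𝕜)) := by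
  rw [hM.charpoly_eq]
  exact (Equiv.prod_comp (Fintype.equivOfCardEq (Fintype.card_fin _)).symm
    fun i => X - C (hM.eigenvalues₀ i : 𝕜)).trans
    (Equiv.prod_comp (finCongr (Fintype.card_fin n).symm)
      fun i => X - C (hM.eigenvalues₀ i : 𝕜)).symm

lemma eigenvalueDesc_eq_eigenvalues₀ (hM : M.IsHermitian) (i : Fin n) :
    eigenvalueDesc M (i + 1) = hM.eigenvalues₀ (Fin.cast (Fintype.card_fin n).symm i) :=
  eigenvalueDesc_eq_of_charpoly (f := hM.eigenvalues₀ ∘ Fin.cast (Fintype.card_fin n).symm)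
    (fun _ _ h => hM.eigenvalues₀_antitone h) (charpoly_eq_prod_eigenvalues₀ hM) i

lemma antitone_eigenvalueDesc (hM : M.IsHermitian) :
    Antitone fun i : Fin n => eigenvalueDesc M (i + 1) := by
  simp only [eigenvalueDesc_eq_eigenvalues₀ hM]
  exact fun _ _ h => hM.eigenvalues₀_antitone h

lemma charpoly_eq_prod_eigenvalueDesc (hM : M.IsHermitian) :
    M.charpoly = ∏ i : Fin n, (X - C (eigenvalueDesc M (i + 1) : 𝕜)) := by
  simpa only [eigenvalueDesc_eq_eigenvalues₀ hM] using charpoly_eq_prod_eigenvalues₀ hM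

lemma eigenvalueDesc_nonneg {n : ℕ} {M : Matrix (Fin n) (Fin n) 𝕜} (hM : M.PosSemidef)
    (i : Fin n) : 0 ≤ eigenvalueDesc M (i + 1) := by
  rw [eigenvalueDesc_eq_eigenvalues₀ hM.isHermitian]
  simpa [IsHermitian.eigenvalues] using hM.eigenvalues_nonneg
    (Fintype.equivOfCardEq (Fintype.card_fin _) (Fin.cast (Fintype.card_fin n).symm i))

lemma exists_unitary_eigenvalueDesc (hM : M.IsHermitian) :
    ∃ W ∈ unitaryGroup (Fin n) 𝕜,
      M = W * (diagonal fun i : Fin n => (eigenvalueDesc M (i + 1) : 𝕜)) * star W :=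
  exists_unitary_diagonal_of_charpoly_eq hM (charpoly_eq_prod_eigenvalueDesc hM)

lemma eigenvalueDesc_neg (hM : M.IsHermitian) (hk : k < n) :
    eigenvalueDesc (-M) (k + 1) = -eigenvalueDesc M (n - k) := by
  obtain ⟨W, hW, hMW⟩ := exists_unitary_eigenvalueDesc hM
  have hneg : (-M).charpoly =
      ∏ i : Fin n, (X - C ((-eigenvalueDesc M (i.rev + 1) : ℝ) : 𝕜)) := by
    refine Eq.trans ?_ (Equiv.prod_comp Fin.revPerm
      fun i : Fin n => X - C ((-eigenvalueDesc M (i + 1) : ℝ) : 𝕜)).symm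
    rw [← charpoly_diagonal, ← charpoly_unitary_conj hW (diagonal _)]
    conv_lhs => rw [hMW]
    simp [← diagonal_neg]
  have hanti : Antitone fun i : Fin n => -eigenvalueDesc M (i.rev + 1) := fun i j hij =>
    neg_le_neg (antitone_eigenvalueDesc hM (Fin.rev_le_rev.2 hij))
  convert eigenvalueDesc_eq_of_charpoly hanti hneg ⟨k, hk⟩ using 3
  simp only [Fin.val_rev]
  omega

lemma exists_quadForm_le_eigenvalueDesc (hM : M.IsHermitian) (hk : k < n) :
    ∃ L : (Fin n → 𝕜) →ₗ[𝕜] (Fin k → 𝕜),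
      ∀ x, L x = 0 → quadForm M x ≤ eigenvalueDesc M (k + 1) * normSq x := by
  obtain ⟨W, hW, hMW⟩ := exists_unitary_eigenvalueDesc hM
  refine ⟨LinearMap.funLeft 𝕜 𝕜 (Fin.castLE hk.le) ∘ₗ (star W).mulVecLin, fun x hx => ?_⟩
  conv_lhs => rw [hMW]
  nth_rewrite 1 [← star_star W]
  rw [star_eq_conjTranspose, ← quadForm_mulVec, quadForm_diagonal, ← normSq_star_mulVec hW,
    normSq, Finset.mul_sum]
  refine Finset.sum_le_sum fun j _ => ?_
  rcases lt_or_ge (j : ℕ) k with hj | hj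
  · have : (star W *ᵥ x) j = 0 := congrFun hx ⟨j, hj⟩
    simp [this]
  · exact mul_le_mul_of_nonneg_right (antitone_eigenvalueDesc hM (a := ⟨k, hk⟩) hj) (by positivity)

lemma exists_eigenvalueDesc_le_quadForm (hM : M.IsHermitian) (hk : k < n) :
    ∃ L : (Fin n → 𝕜) →ₗ[𝕜] (Fin (n - 1 - k) → 𝕜),
      ∀ x, L x = 0 → eigenvalueDesc M (k + 1) * normSq x ≤ quadForm M x := by
  obtain ⟨L, hL⟩ := exists_quadForm_le_eigenvalueDesc hM.neg (by omega : n - 1 - k < n)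
  refine ⟨L, fun x hx => ?_⟩
  have := hL x hx
  rw [quadForm_neg, eigenvalueDesc_neg hM (by omega),
    show n - (n - 1 - k) = k + 1 by omega] at this
  linarith

lemma lt_eigenvalueDesc_of_lt_quadForm {κ : Type*} [Fintype κ] (hM : M.IsHermitian) {c : ℝ}
    (A : Matrix (Fin n) κ 𝕜) (hkn : k < n) (hk : k < Fintype.card κ)
    (h : ∀ w ≠ 0, c * normSq (A *ᵥ w) < quadForm M (A *ᵥ w)) : c < eigenvalueDesc M (k + 1) := by
  obtain ⟨L, hL⟩ := exists_quadForm_le_eigenvalueDesc hM hkn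
  have hker : LinearMap.ker (L ∘ₗ A.mulVecLin) ≠ ⊥ :=
    LinearMap.ker_ne_bot_of_finrank_lt (by simpa using hk)
  obtain ⟨w, hw, hw0⟩ := (Submodule.ne_bot_iff _).1 hker
  exact lt_of_mul_lt_mul_right ((h w hw0).trans_le (hL _ hw)) (normSq_nonneg _)

lemma eigenvalueDesc_le_of_quadForm_le {κ : Type*} [Fintype κ] (hM : M.IsHermitian) {c : ℝ}
    (L : (Fin n → 𝕜) →ₗ[𝕜] (κ → 𝕜)) (hkn : k < n) (hk : Fintype.card κ ≤ k)
    (h : ∀ x, L x = 0 → quadForm M x ≤ c * normSq x) : eigenvalueDesc M (k + 1) ≤ c := by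
  obtain ⟨L', hL'⟩ := exists_eigenvalueDesc_le_quadForm hM hkn
  have hker : LinearMap.ker (L.prod L') ≠ ⊥ :=
    LinearMap.ker_ne_bot_of_finrank_lt (by simp; omega)
  obtain ⟨x, hx, hx0⟩ := (Submodule.ne_bot_iff _).1 hker
  obtain ⟨hx1, hx2⟩ := Prod.ext_iff.1 (LinearMap.mem_ker.1 hx)
  exact le_of_mul_le_mul_right ((hL' x hx2).trans (h x hx1)) (normSq_pos hx0)

lemma lt_quadForm_of_lt_eigenvalueDesc (hM : M.IsHermitian) {q : ℝ}
    (h : eigenvalueDesc M 1 < q) {x : Fin n → 𝕜} (hx : x ≠ 0) :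
    quadForm M x < q * normSq x := by
  obtain ⟨i, -⟩ := Function.ne_iff.1 hx
  obtain ⟨L, hL⟩ := exists_quadForm_le_eigenvalueDesc hM i.pos
  exact (hL x (Subsingleton.elim _ _)).trans_lt (mul_lt_mul_of_pos_right h (normSq_pos hx))

end Eigenvalues

section Perturbation

variable {ι : Type*} [Fintype ι]

lemma abs_quadForm_le (M : Matrix ι ι 𝕜) (x : ι → 𝕜) :
    |quadForm M x| ≤ (∑ i, ∑ j, ‖M i j‖) * normSq x := by
  have hcoord (i : ι) : ‖x i‖ ^ 2 ≤ normSq x :=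
    Finset.single_le_sum (f := fun i => ‖x i‖ ^ 2) (fun _ _ => by positivity) (Finset.mem_univ i)
  calc |quadForm M x| ≤ ∑ i, ∑ j, ‖x i‖ * (‖M i j‖ * ‖x j‖) := by
        refine (RCLike.abs_re_le_norm _).trans ?_
        simp only [dotProduct, mulVec, Finset.mul_sum]
        refine (norm_sum_le _ _).trans (Finset.sum_le_sum fun i _ => ?_)
        refine (norm_sum_le _ _).trans (Finset.sum_le_sum fun j _ => ?_)
        simp
    _ ≤ ∑ i, ∑ j, ‖M i j‖ * normSq x := by
        refine Finset.sum_le_sum fun i _ => Finset.sum_le_sum fun j _ => ?_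
        rw [mul_left_comm]
        refine mul_le_mul_of_nonneg_left ?_ (norm_nonneg _)
        nlinarith [hcoord i, hcoord j, sq_nonneg (‖x i‖ - ‖x j‖)]
    _ = (∑ i, ∑ j, ‖M i j‖) * normSq x := by simp only [Finset.sum_mul]

lemma eventually_quadForm_pos {α : Type*} {l : Filter α} {M : α → Matrix ι ι 𝕜}
    {L : Matrix ι ι 𝕜} (hM : Tendsto M l (𝓝 L)) {δ : ℝ} (hδ : 0 < δ)
    (hL : ∀ x, δ * normSq x ≤ quadForm L x) : ∀ᶠ a in l, ∀ x ≠ 0, 0 < quadForm (M a) x := by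
  have hdist : Tendsto (fun a => ∑ i, ∑ j, ‖(M a - L) i j‖) l (𝓝 0) := by
    have hentry (i j : ι) : Tendsto (fun a => ‖(M a - L) i j‖) l (𝓝 0) := by
      simpa using (((tendsto_pi_nhds.1 (tendsto_pi_nhds.1 hM i) j).sub_const (L i j)).norm)
    simpa using tendsto_finsetSum Finset.univ fun i _ => tendsto_finsetSum Finset.univ
      fun j _ => hentry i j
  filter_upwards [hdist.eventually_lt_const hδ] with a ha x hx
  have hsmall := mul_lt_mul_of_pos_right ha (normSq_pos hx)
  have hdev := (abs_le.1 (abs_quadForm_le (M a - L) x)).1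
  rw [quadForm_sub] at hdev
  linarith [hL x]

variable {n k : ℕ}

/-- The compression `Bᴴ (z - X)⁻¹ B` of the resolvent of `X` at `z` to the columns of `B`. -/
def compressedResolvent (X : Matrix (Fin n) (Fin n) 𝕜) (B : Matrix (Fin n) ι 𝕜) (z : ℝ) :
    Matrix ι ι 𝕜 :=
  Bᴴ * ((z : 𝕜) • 1 - X)⁻¹ * B

variable {X : Matrix (Fin n) (Fin n) 𝕜} {B : Matrix (Fin n) ι 𝕜} {q c : ℝ}

lemma isHermitian_smul_one_sub (hX : X.IsHermitian) : ((q : 𝕜) • 1 - X).IsHermitian :=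
  IsHermitian.sub (by simp [IsHermitian, conjTranspose_smul]) hX

lemma isUnit_det_smul_one_sub (hX : X.IsHermitian) (hq : eigenvalueDesc X 1 < q) :
    IsUnit ((q : 𝕜) • 1 - X).det := by
  refine isUnit_iff_ne_zero.2 fun hdet => ?_
  obtain ⟨x, hx, hx0⟩ := exists_mulVec_eq_zero_iff.2 hdet
  have h0 : quadForm ((q : 𝕜) • 1 - X) x = 0 := by rw [quadForm, hx0]; simp
  rw [quadForm_sub, quadForm_smul_one] at h0
  linarith [lt_quadForm_of_lt_eigenvalueDesc hX hq hx]

/-- Completing the square: a bound on the compression of the resolvent by `c⁻¹` amounts to the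
operator inequality `c B Bᴴ ≤ q - X`. -/
lemma mul_normSq_conjTranspose_mulVec_le (hX : X.IsHermitian) (hq : eigenvalueDesc X 1 < q)
    (hc : 0 ≤ c) (hK : ∀ y, c * quadForm (compressedResolvent X B q) y ≤ normSq y)
    (x : Fin n → 𝕜) : c * normSq (Bᴴ *ᵥ x) ≤ q * normSq x - quadForm X x := by
  have hunit := isUnit_det_smul_one_sub hX hq
  have hherm := (isHermitian_smul_one_sub (q := q) hX).inv
  rw [← quadForm_smul_one q, ← quadForm_sub]
  set D := (q : 𝕜) • 1 - X with hD
  set u := x - (D⁻¹ * B) *ᵥ ((c : 𝕜) • Bᴴ *ᵥ x) with hu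
  have hexpand : quadForm D u = quadForm D x - 2 * c * normSq (Bᴴ *ᵥ x) +
      c ^ 2 * quadForm (compressedResolvent X B q) (Bᴴ *ᵥ x) := by
    have hux : u = (1 - (c : 𝕜) • (D⁻¹ * B * Bᴴ)) *ᵥ x := by
      rw [hu, sub_mulVec, one_mulVec, smul_mulVec, mulVec_smul, mulVec_mulVec]
    have hmat : (1 - (c : 𝕜) • (D⁻¹ * B * Bᴴ))ᴴ * D * (1 - (c : 𝕜) • (D⁻¹ * B * Bᴴ)) =
        D - ((2 * c : ℝ) : 𝕜) • (Bᴴᴴ * Bᴴ) +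
          ((c ^ 2 : ℝ) : 𝕜) • (Bᴴᴴ * compressedResolvent X B q * Bᴴ) := by
      simp only [conjTranspose_sub, conjTranspose_smul, conjTranspose_mul, conjTranspose_one,
        conjTranspose_conjTranspose, hherm.eq, compressedResolvent, ← hD, Matrix.sub_mul,
        Matrix.mul_sub, Matrix.smul_mul, Matrix.mul_smul, Matrix.one_mul, Matrix.mul_one,
        Matrix.mul_assoc, Matrix.mul_nonsing_inv_cancel_left _ _ hunit,
        Matrix.nonsing_inv_mul _ hunit, RCLike.star_def, RCLike.conj_ofReal]
      push_cast
      module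
    rw [hux, quadForm_mulVec, hmat, quadForm_add, quadForm_sub, quadForm_smul, quadForm_smul,
      normSq_mulVec, quadForm_mulVec]
  have hpos : 0 ≤ quadForm D u := by
    rcases eq_or_ne u 0 with h0 | h0
    · simp [h0, quadForm]
    · rw [hD, quadForm_sub, quadForm_smul_one]
      linarith [lt_quadForm_of_lt_eigenvalueDesc hX hq h0]
  nlinarith [mul_le_mul_of_nonneg_left (hK (Bᴴ *ᵥ x)) hc]

variable [DecidableEq ι] {θ : ι → ℝ}

/-- The perturbation `X + B Θ Bᴴ` of `X`, where `Θ` is the diagonal matrix with entries `θ`; its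
rank is at most the number of columns of `B`. -/
def finiteRankUpdate (X : Matrix (Fin n) (Fin n) 𝕜) (B : Matrix (Fin n) ι 𝕜) (θ : ι → ℝ) :
    Matrix (Fin n) (Fin n) 𝕜 :=
  X + B * (diagonal fun i => (θ i : 𝕜)) * Bᴴ

lemma isHermitian_finiteRankUpdate (hX : X.IsHermitian) :
    (finiteRankUpdate X B θ).IsHermitian :=
  hX.add (isHermitian_mul_mul_conjTranspose B (isHermitian_diagonal_ofReal θ))

lemma quadForm_finiteRankUpdate (x : Fin n → 𝕜) :
    quadForm (finiteRankUpdate X B θ) x = quadForm X x + ∑ i, θ i * ‖(Bᴴ *ᵥ x) i‖ ^ 2 := by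
  rw [finiteRankUpdate, quadForm_add, ← quadForm_diagonal, quadForm_mulVec,
    conjTranspose_conjTranspose]

lemma resolvent_compression_identity (hX : X.IsHermitian) (hq : eigenvalueDesc X 1 < q) :
    (((q : 𝕜) • 1 - X)⁻¹ * B)ᴴ * (finiteRankUpdate X B θ - (q : 𝕜) • 1) *
        (((q : 𝕜) • 1 - X)⁻¹ * B) =
      compressedResolvent X B q * (diagonal fun i => (θ i : 𝕜)) * compressedResolvent X B q -
        compressedResolvent X B q := by
  have hunit := isUnit_det_smul_one_sub hX hq
  have hherm := (isHermitian_smul_one_sub (q := q) hX).inv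
  set D := (q : 𝕜) • 1 - X with hD
  have hsplit : finiteRankUpdate X B θ - (q : 𝕜) • 1 =
      B * (diagonal fun i => (θ i : 𝕜)) * Bᴴ - D := by
    rw [finiteRankUpdate, hD]; abel
  rw [hsplit, conjTranspose_mul, hherm.eq, compressedResolvent, ← hD]
  simp only [Matrix.mul_sub, Matrix.sub_mul, Matrix.mul_assoc]
  rw [Matrix.mul_nonsing_inv_cancel_left _ _ hunit]

/-- The test space is spanned by the vectors `(q - X)⁻¹ B e`, on which the form of
`X + B Θ Bᴴ - q` is expressed through the compressed resolvent. -/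
lemma lt_eigenvalueDesc_finiteRankUpdate (hX : X.IsHermitian) (hq : eigenvalueDesc X 1 < q)
    {κ : Type*} [Fintype κ] (e : κ → ι) (hkn : k < n) (hk : k < Fintype.card κ)
    (h : ∀ w ≠ 0, 0 < quadForm ((compressedResolvent X B q * (diagonal fun i => (θ i : 𝕜)) *
      compressedResolvent X B q - compressedResolvent X B q).submatrix e e) w) :
    q < eigenvalueDesc (finiteRankUpdate X B θ) (k + 1) := by
  refine lt_eigenvalueDesc_of_lt_quadForm (isHermitian_finiteRankUpdate hX)
    ((((q : 𝕜) • 1 - X)⁻¹ * B).submatrix id e) hkn hk fun w hw => ?_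
  have hpos := h w hw
  rw [← resolvent_compression_identity hX hq] at hpos
  have hform := quadForm_mulVec (finiteRankUpdate X B θ - (q : 𝕜) • 1)
    ((((q : 𝕜) • 1 - X)⁻¹ * B).submatrix id e) w
  rw [quadForm_sub, quadForm_smul_one] at hform
  exact sub_pos.1 (hform ▸ hpos)

lemma eigenvalueDesc_finiteRankUpdate_le (hX : X.IsHermitian) (hq : eigenvalueDesc X 1 < q)
    (hc : 0 ≤ c) (hkn : k < n) (hk : Fintype.card {i // c < θ i} ≤ k)
    (hK : ∀ y, c * quadForm (compressedResolvent X B q) y ≤ normSq y) :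
    eigenvalueDesc (finiteRankUpdate X B θ) (k + 1) ≤ q := by
  refine eigenvalueDesc_le_of_quadForm_le (κ := {i // c < θ i}) (isHermitian_finiteRankUpdate hX)
    (LinearMap.funLeft 𝕜 𝕜 Subtype.val ∘ₗ Bᴴ.mulVecLin) hkn hk fun x hx => ?_
  have hle : ∑ i, θ i * ‖(Bᴴ *ᵥ x) i‖ ^ 2 ≤ c * normSq (Bᴴ *ᵥ x) := by
    rw [normSq, Finset.mul_sum]
    refine Finset.sum_le_sum fun i _ => ?_
    rcases lt_or_ge c (θ i) with hi | hi
    · have : (Bᴴ *ᵥ x) i = 0 := congrFun hx ⟨i, hi⟩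
      simp [this]
    · gcongr
  rw [quadForm_finiteRankUpdate]
  linarith [mul_normSq_conjTranspose_mulVec_le hX hq hc hK x]

lemma eigenvalueDesc_add_card_le_finiteRankUpdate (hX : X.IsHermitian)
    (hk : k + Fintype.card ι < n) :
    eigenvalueDesc X (k + Fintype.card ι + 1) ≤
      eigenvalueDesc (finiteRankUpdate X B θ) (k + 1) := by
  obtain ⟨L, hL⟩ := exists_quadForm_le_eigenvalueDesc
    (isHermitian_finiteRankUpdate (B := B) (θ := θ) hX) (by omega : k < n)
  refine eigenvalueDesc_le_of_quadForm_le (κ := Fin k ⊕ ι) hX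
    ((LinearEquiv.sumArrowLequivProdArrow (Fin k) ι 𝕜 𝕜).symm ∘ₗ L.prod Bᴴ.mulVecLin) hk
    (by simp) fun x hx => ?_
  obtain ⟨hLx, hBx⟩ := Prod.ext_iff.1 ((LinearEquiv.map_eq_zero_iff
    (LinearEquiv.sumArrowLequivProdArrow (Fin k) ι 𝕜 𝕜).symm).1 hx)
  have hB0 : Bᴴ *ᵥ x = 0 := hBx
  simpa [quadForm_finiteRankUpdate, hB0] using hL x hLx

lemma eventually_lt_eigenvalueDesc_finiteRankUpdate {X : ∀ n, Matrix (Fin n) (Fin n) 𝕜}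
    (hX : ∀ n, (X n).IsHermitian) {B : ∀ n, Matrix (Fin n) ι 𝕜} {F : ℝ}
    (hq : ∀ᶠ n in atTop, eigenvalueDesc (X n) 1 < q)
    (hK : Tendsto (fun n => compressedResolvent (X n) (B n) q) atTop (𝓝 ((F : 𝕜) • 1)))
    (hc : 0 < c) (hF : 1 < c * F) (hk : k < Fintype.card {i // c ≤ θ i}) :
    ∀ᶠ n in atTop, q < eigenvalueDesc (finiteRankUpdate (X n) (B n) θ) (k + 1) := by
  have hF0 : 0 < F := pos_of_mul_pos_right (one_pos.trans hF) hc.le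
  let Θ : Matrix ι ι 𝕜 := diagonal fun i => (θ i : 𝕜)
  let e : {i // c ≤ θ i} → ι := Subtype.val
  have hlim : Tendsto (fun n => (compressedResolvent (X n) (B n) q * Θ *
      compressedResolvent (X n) (B n) q - compressedResolvent (X n) (B n) q).submatrix e e) atTop
      (𝓝 (diagonal fun i => ((F * (F * θ (e i) - 1) : ℝ) : 𝕜))) := by
    have hcont : Continuous fun K : Matrix ι ι 𝕜 => (K * Θ * K - K).submatrix e e :=
      (((continuous_id.matrix_mul continuous_const).matrix_mul continuous_id).sub
        continuous_id).matrix_submatrix e e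
    have hval : (diagonal fun i => ((F * (F * θ (e i) - 1) : ℝ) : 𝕜)) =
        (((F : 𝕜) • 1) * Θ * ((F : 𝕜) • 1) - (F : 𝕜) • 1).submatrix e e := by
      ext i j
      rcases eq_or_ne i j with rfl | hij
      · simp [Θ, mul_sub, RCLike.real_smul_eq_coe_mul]
      · simp [Θ, hij, e, Subtype.coe_ne_coe.2 hij]
    rw [hval]
    exact (hcont.tendsto _).comp hK
  have hform := eventually_quadForm_pos hlim (δ := F * (F * c - 1))
    (mul_pos hF0 (by linarith)) fun x => by
      rw [quadForm_diagonal, normSq, Finset.mul_sum]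
      gcongr with i
      exact i.2
  filter_upwards [hq, hform, eventually_gt_atTop k] with n hqn hn hkn
  exact lt_eigenvalueDesc_finiteRankUpdate (hX n) hqn e hkn hk hn

lemma eventually_eigenvalueDesc_finiteRankUpdate_le {X : ∀ n, Matrix (Fin n) (Fin n) 𝕜}
    (hX : ∀ n, (X n).IsHermitian) {B : ∀ n, Matrix (Fin n) ι 𝕜} {F : ℝ}
    (hq : ∀ᶠ n in atTop, eigenvalueDesc (X n) 1 < q)
    (hK : Tendsto (fun n => compressedResolvent (X n) (B n) q) atTop (𝓝 ((F : 𝕜) • 1)))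
    (hc : 0 ≤ c) (hF : c * F < 1) (hk : Fintype.card {i // c < θ i} ≤ k) :
    ∀ᶠ n in atTop, eigenvalueDesc (finiteRankUpdate (X n) (B n) θ) (k + 1) ≤ q := by
  have hlim : Tendsto (fun n => 1 - (c : 𝕜) • compressedResolvent (X n) (B n) q) atTop
      (𝓝 (1 - (c : 𝕜) • (F : 𝕜) • 1)) := (hK.const_smul _).const_sub _
  have hform := eventually_quadForm_pos hlim (sub_pos.2 hF) fun x => by
    rw [quadForm_sub, quadForm_smul, quadForm_smul_one, quadForm_one]
    linarith
  filter_upwards [hq, hform, eventually_gt_atTop k] with n hqn hn hkn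
  refine eigenvalueDesc_finiteRankUpdate_le (hX n) hqn hc hkn hk fun y => ?_
  rcases eq_or_ne y 0 with rfl | hy
  · simp [quadForm, normSq]
  · have := hn y hy
    rw [quadForm_sub, quadForm_smul, quadForm_one] at this
    linarith

/-- The limit `ℓ` of an eigenvalue of the perturbed matrices is where `c F` crosses the level `1`,
or the edge `b` if this happens nowhere beyond `b`; the value `c = 0` is used for the eigenvalues
that do not correspond to a positive `θ`. -/
theorem tendsto_eigenvalueDesc_finiteRankUpdate {X : ∀ n, Matrix (Fin n) (Fin n) 𝕜}
    (hX : ∀ n, (X n).IsHermitian) {B : ∀ n, Matrix (Fin n) ι 𝕜} {b ℓ : ℝ} {F : ℝ → ℝ}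
    (hedge : ∀ k, Tendsto (fun n => eigenvalueDesc (X n) (k + 1)) atTop (𝓝 b))
    (hK : ∀ q : ℚ, b < q →
      Tendsto (fun n => compressedResolvent (X n) (B n) q) atTop (𝓝 ((F q : 𝕜) • 1)))
    (hc : 0 ≤ c) (hbℓ : b ≤ ℓ) (hlow : ∀ q ∈ Ioo b ℓ, 1 < c * F q)
    (hup : ∀ q, ℓ < q → c * F q < 1) (hk : Fintype.card {i // c < θ i} ≤ k)
    (hk' : 0 < c → k < Fintype.card {i // c ≤ θ i}) :
    Tendsto (fun n => eigenvalueDesc (finiteRankUpdate (X n) (B n) θ) (k + 1)) atTop (𝓝 ℓ) := by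
  refine tendsto_order.2 ⟨fun p hp => ?_, fun p hp => ?_⟩
  · rcases lt_or_ge p b with hpb | hpb
    · filter_upwards [(hedge (k + Fintype.card ι)).eventually_const_lt hpb,
        eventually_gt_atTop (k + Fintype.card ι)] with n hn hkn
      exact hn.trans_le (eigenvalueDesc_add_card_le_finiteRankUpdate (hX n) hkn)
    · obtain ⟨q, hpq, hqℓ⟩ := exists_rat_btwn hp
      have hbq := hpb.trans_lt hpq
      have hF := hlow q ⟨hbq, hqℓ⟩
      have hc0 : 0 < c := hc.lt_of_ne fun h => by simp [← h] at hF; linarith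
      filter_upwards [eventually_lt_eigenvalueDesc_finiteRankUpdate hX
        ((hedge 0).eventually_lt_const hbq) (hK q hbq) hc0 hF (hk' hc0)] with n hn
      exact hpq.trans hn
  · obtain ⟨q, hℓq, hqp⟩ := exists_rat_btwn hp
    have hbq := hbℓ.trans_lt hℓq
    filter_upwards [eventually_eigenvalueDesc_finiteRankUpdate_le hX
      ((hedge 0).eventually_lt_const hbq) (hK q hbq) hc (hup q hℓq) hk] with n hn
    exact hn.trans_lt hqp

end Perturbation

section Decay

/-- `f` has on `(b, ∞)` the qualitative shape of a Cauchy-type transform to the right of the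
support: it is strictly decreasing and continuous there and vanishes at infinity. -/
structure DecaysOnIoi (f : ℝ → ℝ) (b : ℝ) : Prop where
  strictAntiOn : StrictAntiOn f (Ioi b)
  continuousOn : ContinuousOn f (Ioi b)
  tendsto_zero : Tendsto f atTop (𝓝 0)

variable {f : ℝ → ℝ} {b ℓ y : ℝ}

lemma DecaysOnIoi.pos (hf : DecaysOnIoi f b) {z : ℝ} (hz : b < z) : 0 < f z := by
  have hz' : b < z + 1 := by linarith
  have hnonneg : 0 ≤ f (z + 1) := by
    refine le_of_tendsto hf.tendsto_zero ?_
    filter_upwards [eventually_ge_atTop (z + 1)] with x hx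
    exact hf.strictAntiOn.antitoneOn hz' (hz'.trans_le hx) hx
  exact hnonneg.trans_lt (hf.strictAntiOn hz hz' (lt_add_one z))

lemma DecaysOnIoi.bijOn (hf : DecaysOnIoi f b) :
    BijOn f (Ioi b) {y | 0 < y ∧ ∃ z > b, y < f z} := by
  refine ⟨fun z hz => ⟨hf.pos hz, ?_⟩, hf.strictAntiOn.injOn, ?_⟩
  · obtain ⟨w, hbw, hwz⟩ := exists_between (mem_Ioi.1 hz)
    exact ⟨w, hbw, hf.strictAntiOn hbw hz hwz⟩
  · rintro y ⟨hy, z₁, hz₁, hy₁⟩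
    obtain ⟨z₂, hy₂, hz₂⟩ :=
      ((hf.tendsto_zero.eventually_lt_const hy).and (eventually_gt_atTop z₁)).exists
    obtain ⟨z, hz, rfl⟩ := intermediate_value_Icc' hz₂.le
      (hf.continuousOn.mono fun z hz => hz₁.trans_le hz.1) ⟨hy₂.le, hy₁.le⟩
    exact ⟨z, hz₁.trans_le hz.1, rfl⟩

/-- `IsLevelPoint f b y ℓ` says that `ℓ` is the point of `[b, ∞)` where a decreasing function `f`
crosses the level `y`, with `ℓ = b` if `f` stays below that level on `(b, ∞)`. -/
def IsLevelPoint (f : ℝ → ℝ) (b y ℓ : ℝ) : Prop :=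
  (b < ℓ ∧ f ℓ = y) ∨ (ℓ = b ∧ ∀ z > b, f z ≤ y)

lemma IsLevelPoint.le (h : IsLevelPoint f b y ℓ) : b ≤ ℓ := by
  rcases h with ⟨h, -⟩ | ⟨h, -⟩
  exacts [h.le, h.ge]

lemma IsLevelPoint.lt_apply (h : IsLevelPoint f b y ℓ) (hf : DecaysOnIoi f b) {q : ℝ}
    (hq : q ∈ Ioo b ℓ) : y < f q := by
  rcases h with ⟨hℓ, rfl⟩ | ⟨rfl, -⟩
  · exact hf.strictAntiOn hq.1 hℓ hq.2
  · exact absurd (hq.1.trans hq.2) (lt_irrefl _)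

lemma IsLevelPoint.apply_lt (h : IsLevelPoint f b y ℓ) (hf : DecaysOnIoi f b) {q : ℝ}
    (hq : ℓ < q) : f q < y := by
  rcases h with ⟨hℓ, rfl⟩ | ⟨rfl, hle⟩
  · exact hf.strictAntiOn hℓ (hℓ.trans hq) hq
  · obtain ⟨w, hw, hwq⟩ := exists_between hq
    exact (hf.strictAntiOn hw hq hwq).trans_le (hle w hw)

lemma DecaysOnIoi.isLevelPoint_ite (hf : DecaysOnIoi f b) (hy : 0 < y) {p : Prop} [Decidable p]
    (hp : p ↔ ∃ z > b, y < f z) :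
    IsLevelPoint f b y (if p then Function.invFunOn f (Ioi b) y else b) := by
  split_ifs with h
  · have hmem : y ∈ f '' Ioi b := hf.bijOn.surjOn ⟨hy, hp.1 h⟩
    exact .inl ⟨Function.invFunOn_mem hmem, Function.invFunOn_eq hmem⟩
  · exact .inr ⟨rfl, fun z hz => not_lt.1 fun hlt => h (hp.2 ⟨z, hz, hlt⟩)⟩

lemma coe_lt_rightLim_iff (hf : AntitoneOn f (Ioi b)) :
    (y : EReal) < Function.rightLim (fun z => (f z : EReal)) b ↔ ∃ z > b, y < f z := by
  have hlim : Function.rightLim (fun z => (f z : EReal)) b =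
      sSup ((fun z => (f z : EReal)) '' Ioi b) :=
    rightLim_eq_of_tendsto (AntitoneOn.tendsto_nhdsGT
      (fun z hz w hw hzw => EReal.coe_le_coe_iff.2 (hf hz hw hzw)) (OrderTop.bddAbove _))
  simp [hlim, lt_sSup_iff]

lemma leftLim_lt_coe_iff {a : ℝ} (hf : AntitoneOn f (Iio a)) :
    Function.leftLim (fun z => (f z : EReal)) a < (y : EReal) ↔ ∃ z < a, f z < y := by
  have hlim : Function.leftLim (fun z => (f z : EReal)) a =
      sInf ((fun z => (f z : EReal)) '' Iio a) :=
    leftLim_eq_of_tendsto (AntitoneOn.tendsto_nhdsLT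
      (fun z hz w hw hzw => EReal.coe_le_coe_iff.2 (hf hz hw hzw)) (OrderBot.bddBelow _))
  simp [hlim, sInf_lt_iff]

lemma one_div_lt_coe_iff {θ : ℝ} (hθ : 0 < θ) {L : EReal} (hL : 0 < L) :
    1 / L < (θ : EReal) ↔ ((1 / θ : ℝ) : EReal) < L := by
  induction L with
  | bot => simp at hL
  | top => simp [hθ]
  | coe x =>
    have hx : 0 < x := by exact_mod_cast hL
    rw [← EReal.coe_one, ← EReal.coe_div, EReal.coe_lt_coe_iff, EReal.coe_lt_coe_iff,
      one_div_lt hx hθ]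

lemma coe_lt_one_div_iff {θ : ℝ} (hθ : θ < 0) {L : EReal} (hL : L < 0) :
    (θ : EReal) < 1 / L ↔ L < ((1 / θ : ℝ) : EReal) := by
  induction L with
  | top => simp at hL
  | bot => simp [hθ]
  | coe x =>
    have hx : x < 0 := by exact_mod_cast hL
    rw [← EReal.coe_one, ← EReal.coe_div, EReal.coe_lt_coe_iff, EReal.coe_lt_coe_iff,
      lt_one_div_of_neg hθ hx]

end Decay

section Transform

section Cauchy

variable {α : Type*} [MeasurableSpace α] {μ : Measure α} {w φ : α → ℝ} {b : ℝ}

lemma ae_norm_div_sub_le (hw0 : 0 ≤ᵐ[μ] w) (hφb : ∀ᵐ t ∂μ, φ t ≤ b) {v z : ℝ} (hv : b < v)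
    (hvz : v ≤ z) : ∀ᵐ t ∂μ, ‖w t / (z - φ t)‖ ≤ w t / (v - b) := by
  filter_upwards [hw0, hφb] with t hwt hφt
  rw [norm_div, Real.norm_of_nonneg hwt, Real.norm_of_nonneg (by linarith)]
  exact div_le_div_of_nonneg_left hwt (by linarith) (by linarith)

lemma integrable_div_sub (hw : Integrable w μ) (hw0 : 0 ≤ᵐ[μ] w) (hφ : AEMeasurable φ μ)
    (hφb : ∀ᵐ t ∂μ, φ t ≤ b) {z : ℝ} (hz : b < z) : Integrable (fun t => w t / (z - φ t)) μ :=
  (hw.div_const (z - b)).mono' (hw.aemeasurable.div (by fun_prop)).aestronglyMeasurable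
    (ae_norm_div_sub_le hw0 hφb hz le_rfl)

lemma strictAntiOn_integral_div_sub (hw : Integrable w μ) (hw0 : 0 ≤ᵐ[μ] w)
    (hpos : ∫ t, w t ∂μ ≠ 0) (hφ : AEMeasurable φ μ) (hφb : ∀ᵐ t ∂μ, φ t ≤ b) :
    StrictAntiOn (fun z => ∫ t, w t / (z - φ t) ∂μ) (Ioi b) := by
  intro z (hz : b < z) v (hv : b < v) hzv
  have hz' := integrable_div_sub hw hw0 hφ hφb hz
  have hv' := integrable_div_sub hw hw0 hφ hφb hv
  have hle : 0 ≤ᵐ[μ] fun t => w t / (z - φ t) - w t / (v - φ t) := by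
    filter_upwards [hw0, hφb] with t hwt hφt
    exact sub_nonneg.2 (div_le_div_of_nonneg_left hwt (by linarith) (by linarith))
  rw [← sub_pos, ← integral_sub hz' hv']
  refine (integral_nonneg_of_ae hle).lt_of_ne' fun h0 => hpos (integral_eq_zero_of_ae ?_)
  filter_upwards [(integral_eq_zero_iff_of_nonneg_ae hle (hz'.sub hv')).1 h0, hw0, hφb]
    with t ht hwt hφt
  by_contra hne
  exact (div_lt_div_of_pos_left (lt_of_le_of_ne' hwt hne) (by linarith)
    (by linarith)).ne' (sub_eq_zero.1 ht)

lemma decaysOnIoi_integral_div_sub (hw : Integrable w μ) (hw0 : 0 ≤ᵐ[μ] w)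
    (hpos : ∫ t, w t ∂μ ≠ 0) (hφ : AEMeasurable φ μ) (hφb : ∀ᵐ t ∂μ, φ t ≤ b) :
    DecaysOnIoi (fun z => ∫ t, w t / (z - φ t) ∂μ) b := by
  have hmeas (z : ℝ) : AEStronglyMeasurable (fun t => w t / (z - φ t)) μ :=
    (hw.aemeasurable.div (by fun_prop)).aestronglyMeasurable
  refine ⟨strictAntiOn_integral_div_sub hw hw0 hpos hφ hφb, fun z (hz : b < z) => ?_, ?_⟩
  · obtain ⟨v, hbv, hvz⟩ := exists_between hz
    refine (continuousAt_of_dominated (Eventually.of_forall hmeas) ?_ (hw.div_const (v - b))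
      ?_).continuousWithinAt
    · filter_upwards [lt_mem_nhds hvz] with u hu using ae_norm_div_sub_le hw0 hφb hbv hu.le
    · filter_upwards [hφb] with t ht
      have : z - φ t ≠ 0 := by linarith
      fun_prop (disch := assumption)
  · rw [← integral_zero α ℝ]
    refine tendsto_integral_filter_of_dominated_convergence _ (Eventually.of_forall hmeas) ?_
      (hw.div_const (b + 1 - b)) (Eventually.of_forall fun t => ?_)
    · filter_upwards [eventually_ge_atTop (b + 1)] with z hz
      exact ae_norm_div_sub_le hw0 hφb (lt_add_one b) hz
    · exact tendsto_const_nhds.div_atTop (tendsto_atTop_add_const_right _ _ tendsto_id)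

end Cauchy

variable {μ : Measure ℝ} {a b θ : ℝ}

lemma ae_mem_Icc_of_support (ha : IsGLB μ.support a) (hb : IsLUB μ.support b) :
    ∀ᵐ t ∂μ, t ∈ Icc a b := by
  filter_upwards [Measure.support_mem_ae (μ := μ)] with t ht
  exact ⟨ha.1 ht, hb.1 ht⟩

lemma integral_id_ne_zero_of_ne_dirac [IsProbabilityMeasure μ] (h_int : Integrable id μ)
    (h0 : ∀ᵐ t ∂μ, 0 ≤ t) (hμ : μ ≠ Measure.dirac 0) : ∫ t, t ∂μ ≠ 0 := fun h => hμ <| by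
  have hae : id =ᵐ[μ] fun _ => (0 : ℝ) := (integral_eq_zero_iff_of_nonneg_ae h0 h_int).1 h
  simpa using Measure.map_congr hae

section Probability

variable [IsProbabilityMeasure μ]

lemma integrable_id_of_ae_mem_Icc (hab : ∀ᵐ t ∂μ, t ∈ Icc a b) : Integrable id μ :=
  Integrable.of_mem_Icc a b aemeasurable_id hab

lemma decaysOnIoi_Ttransform (ha0 : 0 ≤ a) (hab : ∀ᵐ t ∂μ, t ∈ Icc a b)
    (hμ : μ ≠ Measure.dirac 0) : DecaysOnIoi (Ttransform μ) b := by
  have h0 : ∀ᵐ t ∂μ, 0 ≤ t := hab.mono fun t ht => ha0.trans ht.1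
  have h_int := integrable_id_of_ae_mem_Icc hab
  exact decaysOnIoi_integral_div_sub h_int h0 (integral_id_ne_zero_of_ne_dirac h_int h0 hμ)
    aemeasurable_id (hab.mono fun t ht => ht.2)

lemma decaysOnIoi_neg_Ttransform_neg (ha0 : 0 ≤ a) (hab : ∀ᵐ t ∂μ, t ∈ Icc a b)
    (hμ : μ ≠ Measure.dirac 0) : DecaysOnIoi (fun z => -Ttransform μ (-z)) (-a) := by
  have h0 : ∀ᵐ t ∂μ, 0 ≤ t := hab.mono fun t ht => ha0.trans ht.1
  have h_int := integrable_id_of_ae_mem_Icc hab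
  have hT (z : ℝ) : -Ttransform μ (-z) = ∫ t, t / (z - -t) ∂μ := by
    rw [Ttransform, ← integral_neg]
    exact integral_congr_ae (.of_forall fun t => by
      change -(t / (-z - t)) = t / (z - -t)
      rw [← div_neg, neg_sub', neg_neg])
  simp only [hT]
  exact decaysOnIoi_integral_div_sub h_int h0 (integral_id_ne_zero_of_ne_dirac h_int h0 hμ)
    measurable_neg.aemeasurable (hab.mono fun t ht => neg_le_neg ht.1)

end Probability

lemma coe_lt_TtransformRight_iff (hT : DecaysOnIoi (Ttransform μ) b) {y : ℝ} :
    (y : EReal) < TtransformRight μ b ↔ ∃ z > b, y < Ttransform μ z :=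
  coe_lt_rightLim_iff hT.strictAntiOn.antitoneOn

lemma TtransformLeft_lt_coe_iff (hT : DecaysOnIoi (fun z => -Ttransform μ (-z)) (-a)) {y : ℝ} :
    TtransformLeft μ a < (y : EReal) ↔ ∃ z < a, Ttransform μ z < y := by
  refine leftLim_lt_coe_iff fun z hz w hw hzw => ?_
  simpa using hT.strictAntiOn.antitoneOn (mem_Ioi.2 (neg_lt_neg hw)) (mem_Ioi.2 (neg_lt_neg hz))
    (neg_le_neg hzw)

lemma bijOn_Ttransform_Ioi (hT : DecaysOnIoi (Ttransform μ) b) :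
    BijOn (Ttransform μ) (Ioi b) {y : ℝ | 0 < y ∧ (y : EReal) < TtransformRight μ b} := by
  simpa only [coe_lt_TtransformRight_iff hT] using hT.bijOn

lemma bijOn_Ttransform_Iio (hT : DecaysOnIoi (fun z => -Ttransform μ (-z)) (-a)) :
    BijOn (Ttransform μ) (Iio a) {y : ℝ | TtransformLeft μ a < (y : EReal) ∧ y < 0} := by
  simp only [TtransformLeft_lt_coe_iff hT]
  refine ⟨fun z hz => ?_, fun z hz w hw hzw => ?_, ?_⟩
  · obtain ⟨hpos, w, hw, hlt⟩ := hT.bijOn.mapsTo (mem_Ioi.2 (neg_lt_neg (mem_Iio.1 hz)))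
    simp only [neg_neg, Left.neg_pos_iff, neg_lt_neg_iff] at hpos hlt
    exact ⟨⟨-w, neg_lt.1 hw, hlt⟩, hpos⟩
  · exact neg_injective (hT.bijOn.injOn (mem_Ioi.2 (neg_lt_neg (mem_Iio.1 hz)))
      (mem_Ioi.2 (neg_lt_neg (mem_Iio.1 hw))) (by simpa using hzw))
  · rintro y ⟨⟨w, hw, hlt⟩, hy⟩
    obtain ⟨z, hz, hzy⟩ := hT.bijOn.surjOn
      ⟨neg_pos.2 hy, -w, neg_lt_neg hw, by simpa using neg_lt_neg hlt⟩
    exact ⟨-z, mem_Iio.2 (neg_lt.1 hz), neg_injective hzy⟩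

lemma isLevelPoint_TinvRight (hT : DecaysOnIoi (Ttransform μ) b) (hθ : 0 < θ) :
    IsLevelPoint (Ttransform μ) b (1 / θ)
      (if (θ : EReal) > 1 / TtransformRight μ b then TinvRight μ b (1 / θ) else b) := by
  have hpos : 0 < TtransformRight μ b :=
    (coe_lt_TtransformRight_iff hT).2 ⟨b + 1, lt_add_one b, hT.pos (lt_add_one b)⟩
  exact hT.isLevelPoint_ite (one_div_pos.2 hθ)
    ((one_div_lt_coe_iff hθ hpos).trans (coe_lt_TtransformRight_iff hT))

lemma isLevelPoint_TinvLeft (hT : DecaysOnIoi (fun z => -Ttransform μ (-z)) (-a)) (hθ : θ < 0) :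
    IsLevelPoint (fun z => -Ttransform μ (-z)) (-a) (1 / -θ)
      (-if (θ : EReal) < 1 / TtransformLeft μ a then TinvLeft μ a (1 / θ) else a) := by
  have hneg : Ttransform μ (a - 1) < 0 := by
    simpa using hT.pos (show -a < -(a - 1) by linarith)
  have hL : TtransformLeft μ a < 0 :=
    (TtransformLeft_lt_coe_iff hT).2 ⟨a - 1, sub_one_lt a, hneg⟩
  simp only [coe_lt_one_div_iff hθ hL]
  split_ifs with h
  · have hmem : 1 / θ ∈ Ttransform μ '' Iio a :=
      (bijOn_Ttransform_Iio hT).surjOn ⟨h, one_div_neg.2 hθ⟩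
    refine .inl ⟨neg_lt_neg (Function.invFunOn_mem hmem), ?_⟩
    change -Ttransform μ (- -TinvLeft μ a (1 / θ)) = 1 / -θ
    rw [neg_neg, TinvLeft, Function.invFunOn_eq hmem, one_div_neg_eq_neg_one_div]
  · refine .inr ⟨rfl, fun z hz => ?_⟩
    rw [one_div_neg_eq_neg_one_div, neg_le_neg_iff, ← not_lt]
    exact fun hlt => h ((TtransformLeft_lt_coe_iff hT).2 ⟨-z, neg_lt.1 hz, hlt⟩)

end Transform

section Frobenius

variable {𝕜 : Type*} [RCLike 𝕜] {ι : Type*} [Fintype ι]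

/-- The squared Frobenius norm of a matrix. -/
def frobSq (M : Matrix ι ι 𝕜) : ℝ := ∑ i, ∑ j, ‖M i j‖ ^ 2

lemma frobSq_nonneg (M : Matrix ι ι 𝕜) : 0 ≤ frobSq M := by unfold frobSq; positivity

lemma frobSq_eq_re_trace (M : Matrix ι ι 𝕜) : frobSq M = RCLike.re (Mᴴ * M).trace := by
  simp only [frobSq, Matrix.trace, diag_apply, mul_apply, conjTranspose_apply, RCLike.star_def,
    RCLike.conj_mul, map_sum]
  rw [Finset.sum_comm]
  norm_cast

variable {κ : Type*} [Fintype κ] [DecidableEq κ]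

lemma trace_isometry_conj {V : Matrix ι κ 𝕜} (hV : Vᴴ * V = 1) (M : Matrix κ κ 𝕜) :
    (V * M * Vᴴ).trace = M.trace := by
  rw [trace_mul_comm, ← Matrix.mul_assoc, hV, Matrix.one_mul]

lemma frobSq_isometry_conj {V : Matrix ι κ 𝕜} (hV : Vᴴ * V = 1) (M : Matrix κ κ 𝕜) :
    frobSq (V * M * Vᴴ) = frobSq M := by
  have h : (V * M * Vᴴ)ᴴ * (V * M * Vᴴ) = V * (Mᴴ * M) * Vᴴ := by
    simp only [conjTranspose_mul, conjTranspose_conjTranspose, Matrix.mul_assoc]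
    rw [← Matrix.mul_assoc Vᴴ V, hV, Matrix.one_mul]
  rw [frobSq_eq_re_trace, h, trace_isometry_conj hV, frobSq_eq_re_trace]

lemma frobSq_compression {V : Matrix ι κ 𝕜} (hV : Vᴴ * V = 1) (d : κ → ℝ) (N : Matrix ι ι 𝕜) :
    frobSq (V * (diagonal fun i => (d i : 𝕜)) * Vᴴ * N * (V * (diagonal fun i => (d i : 𝕜)) * Vᴴ))
      = ∑ i, ∑ j, d i ^ 2 * d j ^ 2 * ‖(Vᴴ * N * V) i j‖ ^ 2 := by
  have h : V * (diagonal fun i => (d i : 𝕜)) * Vᴴ * N * (V * (diagonal fun i => (d i : 𝕜)) * Vᴴ)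
      = V * ((diagonal fun i => (d i : 𝕜)) * (Vᴴ * N * V) * diagonal fun i => (d i : 𝕜)) * Vᴴ := by
    simp only [Matrix.mul_assoc]
  rw [h, frobSq_isometry_conj hV]
  simp only [frobSq, mul_diagonal, diagonal_mul, norm_mul, RCLike.norm_ofReal, mul_pow, sq_abs,
    mul_right_comm]

variable [DecidableEq ι]

lemma exists_unitary_mulVec_single (k : ι) (x : ι → 𝕜) :
    ∃ U ∈ unitaryGroup ι 𝕜, U *ᵥ Pi.single k ((√(normSq x) : ℝ) : 𝕜) = x := by
  rcases eq_or_ne x 0 with rfl | hx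
  · exact ⟨1, one_mem _, by simp [normSq]⟩
  have hs : 0 < √(normSq x) := Real.sqrt_pos.2 (normSq_pos hx)
  set v : EuclideanSpace 𝕜 ι := WithLp.toLp 2 (((√(normSq x))⁻¹ : 𝕜) • x) with hv
  have hunit : ‖v‖ = 1 := by
    rw [hv, WithLp.toLp_smul, norm_smul, EuclideanSpace.norm_eq]
    change ‖((√(normSq x) : ℝ) : 𝕜)⁻¹‖ * √(normSq x) = 1
    rw [norm_inv, RCLike.norm_ofReal, abs_of_pos hs, inv_mul_cancel₀ hs.ne']
  have horth : Orthonormal 𝕜 (({k} : Set ι).domRestrict fun _ : ι => v) :=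
    ⟨fun _ => hunit, fun i j hij => absurd (Subsingleton.elim i j) hij⟩
  obtain ⟨b, hb⟩ := horth.exists_orthonormalBasis_extension_of_card_eq (by simp)
  refine ⟨(EuclideanSpace.basisFun ι 𝕜).toBasis.toMatrix b,
    (EuclideanSpace.basisFun ι 𝕜).toMatrix_orthonormalBasis_mem_unitary b, ?_⟩
  ext i
  simp [mulVec_single, Module.Basis.toMatrix_apply, hb k rfl, hv, hs.ne', mul_comm]

lemma exists_unitary_mulVec_eq {x y : ι → 𝕜} (h : normSq x = normSq y) :
    ∃ U ∈ unitaryGroup ι 𝕜, U *ᵥ x = y := by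
  rcases isEmpty_or_nonempty ι with hι | ⟨⟨k⟩⟩
  · exact ⟨1, one_mem _, Subsingleton.elim _ _⟩
  obtain ⟨U, hU, hUx⟩ := exists_unitary_mulVec_single k x
  obtain ⟨V, hV, hVy⟩ := exists_unitary_mulVec_single k y
  refine ⟨V * star U, mul_mem hV (Unitary.star_mem hU), ?_⟩
  nth_rewrite 1 [← hUx]
  rw [mulVec_mulVec, Matrix.mul_assoc, mem_unitaryGroup_iff'.1 hU, Matrix.mul_one, h, hVy]

end Frobenius

section Polarization

variable {𝕜 : Type*} [RCLike 𝕜] {ι : Type*} [Fintype ι]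

lemma normSq_add_smul_le {c : 𝕜} (hc : ‖c‖ ≤ 1) (x y : ι → 𝕜) :
    normSq (x + c • y) ≤ 2 * (normSq x + normSq y) := by
  rw [normSq, normSq, normSq, ← Finset.sum_add_distrib, Finset.mul_sum]
  refine Finset.sum_le_sum fun i _ => ?_
  have h : ‖(x + c • y) i‖ ≤ ‖x i‖ + ‖y i‖ := by
    refine (norm_add_le _ _).trans (add_le_add_right ?_ _)
    simpa using mul_le_of_le_one_left (norm_nonneg (y i)) hc
  exact (pow_le_pow_left₀ (norm_nonneg _) h 2).trans add_sq_le

lemma four_mul_re_star_dotProduct_mulVec {M : Matrix ι ι 𝕜} (hM : M.IsHermitian)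
    (x y : ι → 𝕜) :
    4 * RCLike.re (star x ⬝ᵥ M *ᵥ y) = quadForm M (x + y) - quadForm M (x - y) := by
  have hsym : RCLike.re (star y ⬝ᵥ M *ᵥ x) = RCLike.re (star x ⬝ᵥ M *ᵥ y) := by
    rw [dotProduct_mulVec, ← hM.eq, ← star_mulVec, hM.eq, star_dotProduct, RCLike.star_def,
      RCLike.conj_re]
  simp only [quadForm, mulVec_add, mulVec_sub, star_add, star_sub, add_dotProduct, sub_dotProduct,
    dotProduct_add, dotProduct_sub, map_add, map_sub, hsym]
  ring

lemma norm_star_dotProduct_mulVec_pow_four_le {M : Matrix ι ι 𝕜} (hM : M.IsHermitian)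
    (x y : ι → 𝕜) :
    16 * ‖star x ⬝ᵥ M *ᵥ y‖ ^ 4
      ≤ ∑ k : Fin 4, quadForm M (x + (![1, -1, RCLike.I, -RCLike.I] k : 𝕜) • y) ^ 4 := by
  have hre := four_mul_re_star_dotProduct_mulVec hM x y
  have him := four_mul_re_star_dotProduct_mulVec hM x ((RCLike.I : 𝕜) • y)
  rw [mulVec_smul, dotProduct_smul, smul_eq_mul, RCLike.I_mul_re] at him
  have hnorm := RCLike.norm_sq_eq_def (z := star x ⬝ᵥ M *ᵥ y)
  have hpair : ∀ t p q : ℝ, 4 * t = p - q → 32 * t ^ 4 ≤ p ^ 4 + q ^ 4 := fun t p q h => by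
    have hpq := Even.add_pow_le (n := 4) (a := p) (b := -q) (by decide)
    rw [← sub_eq_add_neg, ← h, Even.neg_pow (by decide)] at hpq
    norm_num [mul_pow] at hpq
    linarith
  simp only [Fin.sum_univ_four, cons_val_zero, cons_val_one, cons_val, one_smul, neg_smul,
    ← sub_eq_add_neg]
  have hsplit : ‖star x ⬝ᵥ M *ᵥ y‖ ^ 4 ≤ 2 * (RCLike.re (star x ⬝ᵥ M *ᵥ y) ^ 4
      + (-RCLike.im (star x ⬝ᵥ M *ᵥ y)) ^ 4) := by
    calc ‖star x ⬝ᵥ M *ᵥ y‖ ^ 4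
        = (RCLike.re (star x ⬝ᵥ M *ᵥ y) ^ 2 + RCLike.im (star x ⬝ᵥ M *ᵥ y) ^ 2) ^ 2 := by
          rw [show 4 = 2 * 2 from rfl, pow_mul, hnorm]; ring
      _ ≤ _ := add_sq_le.trans_eq (by ring)
  linarith [hpair _ _ _ hre, hpair _ _ _ him]

end Polarization

section SignChaos

open scoped BigOperators

variable {ι : Type*} [Fintype ι] [DecidableEq ι]

lemma expect_sign_add_mul_pow_four_le {a : ι} {f g : (ι → ℤˣ) → ℝ}
    (hf : ∀ ε, f (Pi.mulSingle a (-1) * ε) = f ε) (hg : ∀ ε, g (Pi.mulSingle a (-1) * ε) = g ε)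
    {κ σ τ : ℝ} (hκ : 0 ≤ κ) (hσ : 0 ≤ σ) (hτ : 0 ≤ τ) (hfσ : 𝔼 ε, f ε ^ 4 ≤ (3 * κ * σ) ^ 2)
    (hgτ : 𝔼 ε, g ε ^ 4 ≤ (κ * τ) ^ 2) :
    𝔼 ε, (f ε + (ε a : ℤ) * g ε) ^ 4 ≤ (3 * κ * (σ + τ)) ^ 2 := by
  have hflip : 𝔼 ε, (f ε + (ε a : ℤ) * g ε) ^ 4 = 𝔼 ε, (f ε - (ε a : ℤ) * g ε) ^ 4 := by
    refine Fintype.expect_equiv (Equiv.mulLeft (Pi.mulSingle a (-1))) _ _ fun ε => ?_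
    simp [hf, hg]
  have hexpand : 𝔼 ε, (f ε + (ε a : ℤ) * g ε) ^ 4
      = 𝔼 ε, f ε ^ 4 + 6 * 𝔼 ε, f ε ^ 2 * g ε ^ 2 + 𝔼 ε, g ε ^ 4 := by
    have hpoint : ∀ ε : ι → ℤˣ,
        (f ε + (ε a : ℤ) * g ε) ^ 4 + (f ε - (ε a : ℤ) * g ε) ^ 4
          = 2 * (f ε ^ 4 + 6 * (f ε ^ 2 * g ε ^ 2) + g ε ^ 4) := fun ε => by
      rcases Int.units_eq_one_or (ε a) with h | h <;> rw [h] <;> push_cast <;> ring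
    have := Finset.expect_congr (s := Finset.univ) rfl fun ε _ => hpoint ε
    simp only [Finset.expect_add_distrib, ← Finset.mul_expect] at this
    linarith
  have hmixed : 𝔼 ε, f ε ^ 2 * g ε ^ 2 ≤ 3 * κ * σ * (κ * τ) := by
    refine abs_le_of_sq_le_sq' ?_ (by positivity) |>.2
    calc (𝔼 ε, f ε ^ 2 * g ε ^ 2) ^ 2 ≤ (𝔼 ε, (f ε ^ 2) ^ 2) * 𝔼 ε, (g ε ^ 2) ^ 2 :=
          Finset.expect_mul_sq_le_sq_mul_sq _ _ _
      _ = (𝔼 ε, f ε ^ 4) * 𝔼 ε, g ε ^ 4 := by simp only [← pow_mul]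
      _ ≤ (3 * κ * σ) ^ 2 * (κ * τ) ^ 2 := by gcongr
      _ = _ := by ring
  rw [hexpand]
  nlinarith [sq_nonneg (κ * τ)]

lemma expect_sum_sign_pow_four_le (c : ι → ℝ) (s : Finset ι) :
    𝔼 ε : ι → ℤˣ, (∑ i ∈ s, c i * (ε i : ℤ)) ^ 4 ≤ (3 * ∑ i ∈ s, c i ^ 2) ^ 2 := by
  induction s using Finset.induction_on with
  | empty => simp
  | insert a s ha ih =>
    have h := expect_sign_add_mul_pow_four_le (a := a) (f := fun ε => ∑ i ∈ s, c i * (ε i : ℤ))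
      (g := fun _ => c a) (κ := 1) (σ := ∑ i ∈ s, c i ^ 2) (τ := c a ^ 2)
      (fun ε => Finset.sum_congr rfl fun i hi => by
        simp [Pi.mulSingle_eq_of_ne (ne_of_mem_of_not_mem hi ha)])
      (fun _ => rfl) zero_le_one (Finset.sum_nonneg fun _ _ => sq_nonneg _) (sq_nonneg _)
      (by simpa using ih) (by simp [← pow_mul])
    simpa only [Finset.sum_insert ha, mul_one, one_mul, add_comm, mul_comm] using h

lemma expect_sum_sign_mul_sign_pow_four_le {A : ι → ι → ℝ} (hA : ∀ i, A i i = 0)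
    (s : Finset ι) :
    𝔼 ε : ι → ℤˣ, (∑ i ∈ s, ∑ j ∈ s, A i j * ((ε i : ℤ) * (ε j : ℤ))) ^ 4
      ≤ (18 * ∑ i ∈ s, ∑ j ∈ s, A i j ^ 2) ^ 2 := by
  induction s using Finset.induction_on with
  | empty => simp
  | insert a s ha ih =>
    have hflip : ∀ ε : ι → ℤˣ, ∀ i ∈ s, ((Pi.mulSingle a (-1) : ι → ℤˣ) * ε) i = ε i :=
      fun ε i hi => by simp [Pi.mulSingle_eq_of_ne (ne_of_mem_of_not_mem hi ha)]
    have hcross : ∑ j ∈ s, (A a j + A j a) ^ 2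
        ≤ 2 * (∑ j ∈ s, A a j ^ 2 + ∑ j ∈ s, A j a ^ 2) := by
      rw [← Finset.sum_add_distrib, Finset.mul_sum]
      exact Finset.sum_le_sum fun j _ => add_sq_le
    have h := expect_sign_add_mul_pow_four_le (a := a) (κ := 3)
      (f := fun ε => ∑ i ∈ s, ∑ j ∈ s, A i j * ((ε i : ℤ) * (ε j : ℤ)))
      (g := fun ε => ∑ j ∈ s, (A a j + A j a) * (ε j : ℤ))
      (σ := 2 * ∑ i ∈ s, ∑ j ∈ s, A i j ^ 2) (τ := ∑ j ∈ s, (A a j + A j a) ^ 2)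
      (fun ε => Finset.sum_congr rfl fun i hi => Finset.sum_congr rfl fun j hj => by
        rw [hflip ε i hi, hflip ε j hj])
      (fun ε => Finset.sum_congr rfl fun j hj => by rw [hflip ε j hj]) (by norm_num)
      (by positivity) (by positivity) (ih.trans_eq (by ring))
      (expect_sum_sign_pow_four_le _ _)
    have hform : ∀ ε : ι → ℤˣ,
        ∑ i ∈ insert a s, ∑ j ∈ insert a s, A i j * ((ε i : ℤ) * (ε j : ℤ))
          = ∑ i ∈ s, ∑ j ∈ s, A i j * ((ε i : ℤ) * (ε j : ℤ))
            + (ε a : ℤ) * ∑ j ∈ s, (A a j + A j a) * (ε j : ℤ) := fun ε => by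
      simp only [Finset.sum_insert ha, hA, Finset.sum_add_distrib, add_mul, mul_add,
        Finset.mul_sum, mul_left_comm, mul_comm]
      ring
    simp only [hform]
    refine h.trans (pow_le_pow_left₀ (by positivity) ?_ 2)
    simp only [Finset.sum_insert ha, hA, Finset.sum_add_distrib]
    linarith

/-- The real part of a quadratic form at a sign vector is a Rademacher chaos of order two whose
diagonal sums to the trace. -/
lemma expect_quadForm_sign_pow_four_le {𝕜 : Type*} [RCLike 𝕜] {M : Matrix ι ι 𝕜}
    (hM : M.trace = 0) :
    𝔼 ε : ι → ℤˣ, quadForm M (fun i => ((ε i : ℤ) : 𝕜)) ^ 4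
      ≤ (18 * frobSq M) ^ 2 := by
  set A : ι → ι → ℝ := fun i j => if i = j then 0 else RCLike.re (M i j) with hAdef
  have hform : ∀ ε : ι → ℤˣ, quadForm M (fun i => ((ε i : ℤ) : 𝕜))
      = ∑ i, ∑ j, A i j * ((ε i : ℤ) * (ε j : ℤ)) := fun ε => by
    have hdiag : ∑ i, RCLike.re (M i i) = 0 := by simpa [Matrix.trace] using congr(RCLike.re $hM)
    have hentry : ∀ i j, RCLike.re (M i j) * ((ε i : ℤ) * (ε j : ℤ))
        = A i j * ((ε i : ℤ) * (ε j : ℤ)) + if i = j then RCLike.re (M i i) else 0 :=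
      fun i j => by
        rcases eq_or_ne i j with rfl | hij
        · rcases Int.units_eq_one_or (ε i) with h | h <;> simp [hAdef, h]
        · simp [hAdef, hij]
    calc quadForm M (fun i => ((ε i : ℤ) : 𝕜))
        = ∑ i, ∑ j, RCLike.re (M i j) * ((ε i : ℤ) * (ε j : ℤ)) := by
          simp only [quadForm, dotProduct, mulVec, Finset.mul_sum, map_sum, Pi.star_apply]
          refine Finset.sum_congr rfl fun i _ => Finset.sum_congr rfl fun j _ => ?_
          rcases Int.units_eq_one_or (ε i) with h | h <;>
            rcases Int.units_eq_one_or (ε j) with h' | h' <;> simp [h, h']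
      _ = _ := by simp [hentry, Finset.sum_add_distrib, hdiag]
  simp only [hform]
  refine (expect_sum_sign_mul_sign_pow_four_le (fun i => by simp [hAdef]) _).trans ?_
  have hA : ∀ i j, A i j ^ 2 ≤ ‖M i j‖ ^ 2 := fun i j => by
    by_cases hij : i = j
    · simp [hAdef, hij]
    · simpa [hAdef, hij] using pow_le_pow_left₀ (abs_nonneg _) (RCLike.abs_re_le_norm (M i j)) 2
  rw [frobSq]
  gcongr (18 * ∑ i, ∑ j, ?_) ^ 2
  exact hA _ _

end SignChaos

section Scaling

variable {𝕜 : Type*} [RCLike 𝕜] {ι : Type*} [Fintype ι]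

lemma normSq_smul (c : 𝕜) (x : ι → 𝕜) : normSq (c • x) = ‖c‖ ^ 2 * normSq x := by
  simp [normSq, Finset.mul_sum, mul_pow]

lemma quadForm_smul_vec (M : Matrix ι ι 𝕜) (c : 𝕜) (x : ι → 𝕜) :
    quadForm M (c • x) = ‖c‖ ^ 2 * quadForm M x := by
  rw [quadForm, quadForm, mulVec_smul, star_smul, smul_dotProduct, dotProduct_smul, smul_eq_mul,
    smul_eq_mul, ← mul_assoc, RCLike.star_def, RCLike.conj_mul, ← RCLike.ofReal_pow,
    RCLike.re_ofReal_mul]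

end Scaling

section Haar

open scoped BigOperators

variable {𝕜 : Type*} [RCLike 𝕜] {n : ℕ}

instance instBorelSpaceMatrix : BorelSpace (Matrix (Fin n) (Fin n) 𝕜) :=
  inferInstanceAs (BorelSpace (Fin n → Fin n → 𝕜))

instance instSecondCountableTopologyMatrix : SecondCountableTopology (Matrix (Fin n) (Fin n) 𝕜) :=
  inferInstanceAs (SecondCountableTopology (Fin n → Fin n → 𝕜))

instance instBorelSpaceUnitaryGroup : BorelSpace (unitaryGroup (Fin n) 𝕜) := Subtype.borelSpace _

instance instCompactSpaceUnitaryGroup : CompactSpace (unitaryGroup (Fin n) 𝕜) := by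
  refine isCompact_iff_compactSpace.1 ?_
  have hK : IsCompact (Set.univ.pi fun _ : Fin n => Set.univ.pi fun _ : Fin n =>
      Metric.closedBall (0 : 𝕜) 1) :=
    isCompact_univ_pi fun _ => isCompact_univ_pi fun _ => isCompact_closedBall _ _
  refine IsCompact.of_isClosed_subset (X := Matrix (Fin n) (Fin n) 𝕜) hK isClosed_unitary
    fun U hU i _ j _ => ?_
  simpa using entry_norm_bound_of_unitary hU i j

/-- The Haar probability measure on the unitary group of `𝕜^n`. -/
def haarUnitary (n : ℕ) (𝕜 : Type*) [RCLike 𝕜] : Measure (unitaryGroup (Fin n) 𝕜) :=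
  Measure.haarMeasure ⊤

instance instIsProbabilityMeasureHaarUnitary : IsProbabilityMeasure (haarUnitary n 𝕜) :=
  ⟨Measure.haarMeasure_self⟩

instance instIsMulLeftInvariantHaarUnitary : (haarUnitary n 𝕜).IsMulLeftInvariant := by
  unfold haarUnitary
  infer_instance

lemma integrable_haarUnitary {f : unitaryGroup (Fin n) 𝕜 → ℝ} (hf : Continuous f) :
    Integrable f (haarUnitary n 𝕜) :=
  hf.integrable_of_hasCompactSupport (HasCompactSupport.of_compactSpace _)

/-- The conjugate `U M U⁻¹` of a matrix by an element of the unitary group. -/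
def unitaryConj (U : unitaryGroup (Fin n) 𝕜) (M : Matrix (Fin n) (Fin n) 𝕜) :
    Matrix (Fin n) (Fin n) 𝕜 :=
  (U : Matrix (Fin n) (Fin n) 𝕜) * M * star (U : Matrix (Fin n) (Fin n) 𝕜)

lemma isHermitian_unitaryConj (U : unitaryGroup (Fin n) 𝕜) {M : Matrix (Fin n) (Fin n) 𝕜}
    (hM : M.IsHermitian) : (unitaryConj U M).IsHermitian := by
  simpa [unitaryConj, star_eq_conjTranspose] using
    isHermitian_mul_mul_conjTranspose (U : Matrix (Fin n) (Fin n) 𝕜) hM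

lemma frobSq_unitaryConj (U : unitaryGroup (Fin n) 𝕜) (M : Matrix (Fin n) (Fin n) 𝕜) :
    frobSq (unitaryConj U M) = frobSq M :=
  frobSq_isometry_conj (mem_unitaryGroup_iff'.1 U.2) M

lemma trace_unitaryConj (U : unitaryGroup (Fin n) 𝕜) (M : Matrix (Fin n) (Fin n) 𝕜) :
    (unitaryConj U M).trace = M.trace :=
  trace_isometry_conj (mem_unitaryGroup_iff'.1 U.2) M

lemma continuous_unitaryConj (M : Matrix (Fin n) (Fin n) 𝕜) :
    Continuous fun U : unitaryGroup (Fin n) 𝕜 => unitaryConj U M := by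
  unfold unitaryConj
  fun_prop

lemma continuous_quadForm {X : Type*} [TopologicalSpace X] {M : X → Matrix (Fin n) (Fin n) 𝕜}
    (hM : Continuous M) (w : Fin n → 𝕜) : Continuous fun x => quadForm (M x) w :=
  RCLike.continuous_re.comp (continuous_const.dotProduct (hM.matrix_mulVec continuous_const))

lemma quadForm_inv_mul_unitaryConj (V U : unitaryGroup (Fin n) 𝕜)
    (M : Matrix (Fin n) (Fin n) 𝕜) (w : Fin n → 𝕜) :
    quadForm (unitaryConj (V⁻¹ * U) M) w
      = quadForm (unitaryConj U M) ((V : Matrix (Fin n) (Fin n) 𝕜) *ᵥ w) := by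
  rw [quadForm_mulVec]
  simp [unitaryConj, star_eq_conjTranspose, Matrix.mul_assoc]

/-- The Haar average depends only on the norm of the vector because the unitary group acts
transitively on spheres. -/
lemma integral_quadForm_unitaryConj_congr (f : ℝ → ℝ) (M : Matrix (Fin n) (Fin n) 𝕜)
    {v w : Fin n → 𝕜} (h : normSq v = normSq w) :
    ∫ U, f (quadForm (unitaryConj U M) v) ∂(haarUnitary n 𝕜)
      = ∫ U, f (quadForm (unitaryConj U M) w) ∂(haarUnitary n 𝕜) := by
  obtain ⟨V, hV, rfl⟩ := exists_unitary_mulVec_eq h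
  rw [← integral_mul_left_eq_self _ (⟨V, hV⟩ : unitaryGroup (Fin n) 𝕜)⁻¹]
  simp only [quadForm_inv_mul_unitaryConj]

/-- The Haar average can be computed at a flat vector with arbitrary signs, hence by averaging
over the signs. -/
lemma integral_quadForm_unitaryConj_pow_four_le {M : Matrix (Fin n) (Fin n) 𝕜}
    (hM : M.trace = 0) (w : Fin n → 𝕜) :
    ∫ U, quadForm (unitaryConj U M) w ^ 4 ∂(haarUnitary n 𝕜)
      ≤ 324 * normSq w ^ 4 * (frobSq M / n ^ 2) ^ 2 := by
  rcases n.eq_zero_or_pos with rfl | hn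
  · simp [quadForm, frobSq]
  set c : ℝ := √(normSq w / n)
  have hc : c ^ 2 = normSq w / n := Real.sq_sqrt (div_nonneg (normSq_nonneg w) n.cast_nonneg)
  set q : (Fin n → ℤˣ) → unitaryGroup (Fin n) 𝕜 → ℝ := fun ε U =>
    quadForm (unitaryConj U M) (fun i => ((ε i : ℤ) : 𝕜)) ^ 4
  have hq : ∀ ε, Integrable (q ε) (haarUnitary n 𝕜) := fun ε => integrable_haarUnitary
    ((continuous_quadForm (continuous_unitaryConj M) _).pow 4)
  have hflat : ∀ ε : Fin n → ℤˣ,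
      ∫ U, quadForm (unitaryConj U M) w ^ 4 ∂(haarUnitary n 𝕜)
        = (c ^ 2) ^ 4 * ∫ U, q ε U ∂(haarUnitary n 𝕜) := fun ε => by
    have hnorm : normSq w = normSq ((c : 𝕜) • fun i => ((ε i : ℤ) : 𝕜)) := by
      have hsign : normSq (fun i => ((ε i : ℤ) : 𝕜)) = n := by
        have hone : ∀ i, ‖((ε i : ℤ) : 𝕜)‖ = 1 := fun i => by
          rcases Int.units_eq_one_or (ε i) with h | h <;> simp [h]
        simp [normSq, hone]
      rw [normSq_smul, RCLike.norm_ofReal, sq_abs, hc, hsign]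
      field_simp
    rw [integral_quadForm_unitaryConj_congr (· ^ 4) M hnorm, ← integral_const_mul]
    simp only [quadForm_smul_vec, RCLike.norm_ofReal, sq_abs, mul_pow, q]
  have hsum : ∀ U : unitaryGroup (Fin n) 𝕜, 𝔼 ε, q ε U ≤ (18 * frobSq M) ^ 2 := fun U =>
    frobSq_unitaryConj U M ▸ expect_quadForm_sign_pow_four_le ((trace_unitaryConj U M).trans hM)
  calc ∫ U, quadForm (unitaryConj U M) w ^ 4 ∂(haarUnitary n 𝕜)
      = 𝔼 ε : Fin n → ℤˣ, (c ^ 2) ^ 4 * ∫ U, q ε U ∂(haarUnitary n 𝕜) := by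
        simp only [← hflat, Fintype.expect_const]
    _ = (c ^ 2) ^ 4 * ∫ U, 𝔼 ε, q ε U ∂(haarUnitary n 𝕜) := by
        simp only [← Finset.mul_expect, Fintype.expect_eq_sum_div_card, integral_div,
          integral_finsetSum _ fun ε _ => hq ε]
    _ ≤ (c ^ 2) ^ 4 * (18 * frobSq M) ^ 2 := by
        have h_int : Integrable (fun U => 𝔼 ε, q ε U) (haarUnitary n 𝕜) := by
          simpa only [Fintype.expect_eq_sum_div_card] using
            (integrable_finsetSum _ fun ε _ => hq ε).div_const _
        gcongr
        simpa using integral_mono h_int (integrable_const _) hsum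
    _ = _ := by rw [hc]; ring

end Haar

section Concentration

variable {𝕜 : Type*} [RCLike 𝕜] {n : ℕ}

lemma integral_norm_star_dotProduct_unitaryConj_pow_four_le {M : Matrix (Fin n) (Fin n) 𝕜}
    (hM : M.IsHermitian) (htr : M.trace = 0) {x y : Fin n → 𝕜} (hx : normSq x = 1)
    (hy : normSq y = 1) :
    ∫ U, ‖star x ⬝ᵥ unitaryConj U M *ᵥ y‖ ^ 4 ∂(haarUnitary n 𝕜)
      ≤ (144 * (frobSq M / n ^ 2)) ^ 2 := by
  set w : Fin 4 → Fin n → 𝕜 := fun k => x + (![1, -1, RCLike.I, -RCLike.I] k : 𝕜) • y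
  have hw : ∀ k, normSq (w k) ≤ 4 := fun k => by
    refine (normSq_add_smul_le ?_ x y).trans_eq (by rw [hx, hy]; norm_num)
    have hI : ‖(RCLike.I : 𝕜)‖ ≤ 1 := by
      rcases eq_or_ne (RCLike.I : 𝕜) 0 with h | h
      · simp [h]
      · exact (RCLike.norm_I_of_ne_zero h).le
    fin_cases k <;> simp [hI]
  have h_int : ∀ k, Integrable (fun U => quadForm (unitaryConj U M) (w k) ^ 4)
      (haarUnitary n 𝕜) := fun k => integrable_haarUnitary
    ((continuous_quadForm (continuous_unitaryConj M) _).pow 4)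
  have hcont := continuous_unitaryConj M
  have hsum : 16 * ∫ U, ‖star x ⬝ᵥ unitaryConj U M *ᵥ y‖ ^ 4 ∂(haarUnitary n 𝕜)
      ≤ ∑ k, ∫ U, quadForm (unitaryConj U M) (w k) ^ 4 ∂(haarUnitary n 𝕜) := by
    rw [← integral_const_mul, ← integral_finsetSum _ fun k _ => h_int k]
    exact integral_mono (integrable_haarUnitary (by fun_prop))
      (integrable_finsetSum _ fun k _ => h_int k) fun U =>
        norm_star_dotProduct_mulVec_pow_four_le (isHermitian_unitaryConj U hM) x y
  have hterm : ∀ k, ∫ U, quadForm (unitaryConj U M) (w k) ^ 4 ∂(haarUnitary n 𝕜)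
      ≤ 324 * 4 ^ 4 * (frobSq M / n ^ 2) ^ 2 := fun k => by
    refine (integral_quadForm_unitaryConj_pow_four_le htr _).trans ?_
    gcongr
    exacts [normSq_nonneg _, hw k]
  have hfour := Finset.sum_le_sum fun k (_ : k ∈ Finset.univ) => hterm k
  simp only [Finset.sum_const, Finset.card_univ, Fintype.card_fin, nsmul_eq_mul] at hfour
  push_cast at hfour
  linarith

lemma integral_frobSq_compression_sq_le {κ : Type*} [Fintype κ] [DecidableEq κ]
    {M P : Matrix (Fin n) (Fin n) 𝕜} (hM : M.IsHermitian) (htr : M.trace = 0)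
    {V : Matrix (Fin n) κ 𝕜} (hV : Vᴴ * V = 1) {d : κ → ℝ}
    (hP : P = V * (diagonal fun i => (d i : 𝕜)) * Vᴴ) :
    ∫ U, frobSq (P * unitaryConj U M * P) ^ 2 ∂(haarUnitary n 𝕜)
      ≤ (144 * (∑ i, d i ^ 2) ^ 2 * (frobSq M / n ^ 2)) ^ 2 := by
  set a : κ × κ → unitaryGroup (Fin n) 𝕜 → ℝ := fun p U =>
    ‖star (V.col p.1) ⬝ᵥ unitaryConj U M *ᵥ V.col p.2‖
  set c : κ × κ → ℝ := fun p => d p.1 ^ 2 * d p.2 ^ 2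
  have hc : ∀ p, 0 ≤ c p := fun p => by positivity
  have hcsum : ∑ p, c p = (∑ i, d i ^ 2) ^ 2 := by
    rw [Fintype.sum_prod_type, sq, Finset.sum_mul_sum]
  have hform : ∀ U, frobSq (P * unitaryConj U M * P) = ∑ p, c p * a p U ^ 2 := fun U => by
    rw [hP, frobSq_compression hV, Fintype.sum_prod_type]
    simp only [Matrix.mul_assoc]
    rfl
  have hconv := continuous_unitaryConj M
  have h_int : ∀ p, Integrable (fun U => c p * a p U ^ 4) (haarUnitary n 𝕜) := fun p =>
    integrable_haarUnitary (by fun_prop)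
  have hcauchy : ∀ U, frobSq (P * unitaryConj U M * P) ^ 2
      ≤ (∑ p, c p) * ∑ p, c p * a p U ^ 4 := fun U => by
    rw [hform]
    exact Finset.sum_sq_le_sum_mul_sum_of_sq_le_mul _ (fun p _ => hc p)
      (fun p _ => mul_nonneg (hc p) (by positivity)) fun p _ => by
      rw [mul_pow]; exact le_of_eq (by ring)
  have hcol : ∀ i, normSq (V.col i) = 1 := fun i => by
    rw [← mulVec_single_one, normSq_mulVec, hV,
      quadForm_one, normSq, Finset.sum_eq_single i] <;> simp +contextual
  calc ∫ U, frobSq (P * unitaryConj U M * P) ^ 2 ∂(haarUnitary n 𝕜)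
      ≤ ∫ U, (∑ p, c p) * ∑ p, c p * a p U ^ 4 ∂(haarUnitary n 𝕜) :=
        integral_mono (integrable_haarUnitary (by simp only [hform]; fun_prop))
          ((integrable_finsetSum _ fun p _ => h_int p).const_mul _) hcauchy
    _ = (∑ p, c p) * ∑ p, c p * ∫ U, a p U ^ 4 ∂(haarUnitary n 𝕜) := by
        rw [integral_const_mul, integral_finsetSum _ fun p _ => h_int p]
        simp only [integral_const_mul]
    _ ≤ (∑ p, c p) * ∑ p, c p * (144 * (frobSq M / n ^ 2)) ^ 2 := by
        gcongr with p
        exact integral_norm_star_dotProduct_unitaryConj_pow_four_le hM htr (hcol _) (hcol _)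
    _ = _ := by rw [← Finset.sum_mul, hcsum]; ring

end Concentration

section TransformMatrix

variable {𝕜 : Type*} [RCLike 𝕜] {n : ℕ}

/-- The traceless part of a matrix. -/
def traceless (A : Matrix (Fin n) (Fin n) 𝕜) : Matrix (Fin n) (Fin n) 𝕜 :=
  A - (A.trace / n) • (1 : Matrix (Fin n) (Fin n) 𝕜)

lemma trace_traceless (A : Matrix (Fin n) (Fin n) 𝕜) : (traceless A).trace = 0 := by
  rcases Nat.eq_zero_or_pos n with rfl | hn
  · simp [Matrix.trace]
  · have : (n : 𝕜) ≠ 0 := by exact_mod_cast hn.ne'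
    simp [traceless, trace_sub, trace_smul, this]

lemma isHermitian_traceless {A : Matrix (Fin n) (Fin n) 𝕜} (hA : A.IsHermitian) :
    (traceless A).IsHermitian := by
  have htr : star A.trace = A.trace := by rw [← trace_conjTranspose, hA.eq]
  refine hA.sub ?_
  rw [IsHermitian, conjTranspose_smul, conjTranspose_one, star_div₀, htr, star_natCast]

lemma continuous_traceless :
    Continuous (traceless : Matrix (Fin n) (Fin n) 𝕜 → Matrix (Fin n) (Fin n) 𝕜) :=
  continuous_id.sub ((continuous_id.matrix_trace.div_const _).smul continuous_const)

lemma unitaryConj_mul (U : unitaryGroup (Fin n) 𝕜) (A B : Matrix (Fin n) (Fin n) 𝕜) :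
    unitaryConj U (A * B) = unitaryConj U A * unitaryConj U B := by
  simp only [unitaryConj, Matrix.mul_assoc]
  rw [← Matrix.mul_assoc (star (U : Matrix (Fin n) (Fin n) 𝕜)), mem_unitaryGroup_iff'.1 U.2,
    Matrix.one_mul]

lemma unitaryConj_smul_one (U : unitaryGroup (Fin n) 𝕜) (c : 𝕜) :
    unitaryConj U (c • (1 : Matrix (Fin n) (Fin n) 𝕜)) = c • 1 := by
  rw [unitaryConj, Matrix.mul_smul, Matrix.smul_mul, Matrix.mul_one, mem_unitaryGroup_iff.1 U.2]

lemma unitaryConj_sub (U : unitaryGroup (Fin n) 𝕜) (A B : Matrix (Fin n) (Fin n) 𝕜) :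
    unitaryConj U (A - B) = unitaryConj U A - unitaryConj U B := by
  rw [unitaryConj, Matrix.mul_sub, Matrix.sub_mul, unitaryConj, unitaryConj]

lemma unitaryConj_nonsing_inv (U : unitaryGroup (Fin n) 𝕜) (A : Matrix (Fin n) (Fin n) 𝕜) :
    unitaryConj U A⁻¹ = (unitaryConj U A)⁻¹ := by
  have hU := inv_eq_right_inv (mem_unitaryGroup_iff.1 U.2)
  have hU' := inv_eq_right_inv (mem_unitaryGroup_iff'.1 U.2)
  rw [unitaryConj, unitaryConj, Matrix.mul_inv_rev, Matrix.mul_inv_rev, hU, hU', Matrix.mul_assoc]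

lemma unitaryConj_unitaryConj_inv (U : unitaryGroup (Fin n) 𝕜) (A : Matrix (Fin n) (Fin n) 𝕜) :
    unitaryConj U (unitaryConj U⁻¹ A) = A := by
  have hU := mem_unitaryGroup_iff.1 U.2
  simp only [unitaryConj, UnitaryGroup.inv_apply, star_star, Matrix.mul_assoc, hU, Matrix.mul_one]
  rw [← Matrix.mul_assoc, hU, Matrix.one_mul]

lemma traceless_unitaryConj (U : unitaryGroup (Fin n) 𝕜) (A : Matrix (Fin n) (Fin n) 𝕜) :
    traceless (unitaryConj U A) = unitaryConj U (traceless A) := by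
  rw [traceless, trace_unitaryConj, traceless, unitaryConj_sub, unitaryConj_smul_one]

/-- The matrix `X (z - X)⁻¹`, whose normalized trace is the T-transform of the empirical
eigenvalue distribution of `X` at `z`. -/
def transformMatrix (X : Matrix (Fin n) (Fin n) 𝕜) (z : ℝ) : Matrix (Fin n) (Fin n) 𝕜 :=
  X * ((z : 𝕜) • (1 : Matrix (Fin n) (Fin n) 𝕜) - X)⁻¹

lemma commute_smul_one_sub_inv {S X : Matrix (Fin n) (Fin n) 𝕜} (h : Commute S X) (z : 𝕜) :
    Commute S (z • (1 : Matrix (Fin n) (Fin n) 𝕜) - X)⁻¹ := by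
  rw [← Matrix.zpow_neg_one]
  exact Matrix.Commute.zpow_right (((Commute.one_right S).smul_right z).sub_right h) _

lemma isHermitian_transformMatrix {X : Matrix (Fin n) (Fin n) 𝕜} (hX : X.IsHermitian) (z : ℝ) :
    (transformMatrix X z).IsHermitian :=
  (hX.commute_iff (isHermitian_smul_one_sub hX).inv).1 (commute_smul_one_sub_inv (.refl X) z)

lemma transformMatrix_unitaryConj (U : unitaryGroup (Fin n) 𝕜) (X : Matrix (Fin n) (Fin n) 𝕜)
    (z : ℝ) : transformMatrix (unitaryConj U X) z = unitaryConj U (transformMatrix X z) := by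
  rw [transformMatrix, transformMatrix, unitaryConj_mul, unitaryConj_nonsing_inv, unitaryConj_sub,
    unitaryConj_smul_one]

lemma measurable_nonsing_inv : Measurable fun M : Matrix (Fin n) (Fin n) 𝕜 => M⁻¹ := by
  simp only [inv_def, Ring.inverse_eq_inv']
  exact (Continuous.matrix_det continuous_id).measurable.inv.smul
    (Continuous.matrix_adjugate continuous_id).measurable

lemma measurable_transformMatrix (z : ℝ) :
    Measurable fun X : Matrix (Fin n) (Fin n) 𝕜 => transformMatrix X z := by
  have hmul : Continuous fun p : Matrix (Fin n) (Fin n) 𝕜 × Matrix (Fin n) (Fin n) 𝕜 =>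
      p.1 * p.2 := continuous_fst.matrix_mul continuous_snd
  exact hmul.measurable.comp (measurable_id.prodMk
    (measurable_nonsing_inv.comp (continuous_const.sub continuous_id).measurable))

end TransformMatrix

section Deviation

variable {𝕜 : Type*} [RCLike 𝕜] {n : ℕ}

/-- The size of the compression by `P` of the traceless part of `X (z - X)⁻¹`, normalized so that
its moments under rotations of `X` are bounded uniformly in `X`. -/
def deviation (z : ℝ) (X P : Matrix (Fin n) (Fin n) 𝕜) : ℝ :=
  frobSq (P * traceless (transformMatrix X z) * P)
    / (1 + frobSq (traceless (transformMatrix X z)) / n)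

lemma deviation_unitaryConj (U : unitaryGroup (Fin n) 𝕜) (z : ℝ)
    (X P : Matrix (Fin n) (Fin n) 𝕜) :
    deviation z (unitaryConj U X) (unitaryConj U P) = deviation z X P := by
  simp only [deviation, transformMatrix_unitaryConj, traceless_unitaryConj, ← unitaryConj_mul,
    frobSq_unitaryConj]

lemma deviation_unitaryConj_left (U : unitaryGroup (Fin n) 𝕜) (z : ℝ)
    (X P : Matrix (Fin n) (Fin n) 𝕜) :
    deviation z (unitaryConj U X) P
      = frobSq (P * unitaryConj U (traceless (transformMatrix X z)) * P)
        / (1 + frobSq (traceless (transformMatrix X z)) / n) := by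
  rw [deviation, transformMatrix_unitaryConj, traceless_unitaryConj, frobSq_unitaryConj]

lemma continuous_frobSq : Continuous (frobSq : Matrix (Fin n) (Fin n) 𝕜 → ℝ) := by
  unfold frobSq
  fun_prop

lemma measurable_deviation (z : ℝ) :
    Measurable fun p : Matrix (Fin n) (Fin n) 𝕜 × Matrix (Fin n) (Fin n) 𝕜 =>
      deviation z p.1 p.2 := by
  have hnum : Continuous fun p : Matrix (Fin n) (Fin n) 𝕜 × Matrix (Fin n) (Fin n) 𝕜 =>
      frobSq (p.2 * p.1 * p.2) :=
    continuous_frobSq.comp ((continuous_snd.matrix_mul continuous_fst).matrix_mul continuous_snd)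
  have hden : Continuous fun p : Matrix (Fin n) (Fin n) 𝕜 × Matrix (Fin n) (Fin n) 𝕜 =>
      1 + frobSq p.1 / n :=
    continuous_const.add ((continuous_frobSq.comp continuous_fst).div_const _)
  have hN : Measurable fun X : Matrix (Fin n) (Fin n) 𝕜 => traceless (transformMatrix X z) :=
    continuous_traceless.measurable.comp (measurable_transformMatrix z)
  have hpair : Measurable fun p : Matrix (Fin n) (Fin n) 𝕜 × Matrix (Fin n) (Fin n) 𝕜 =>
      (traceless (transformMatrix p.1 z), p.2) := (hN.comp measurable_fst).prodMk measurable_snd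
  have hratio := (hnum.measurable.comp hpair).div (hden.measurable.comp hpair)
  exact hratio

lemma integral_deviation_unitaryConj_sq_le (z : ℝ) {X P : Matrix (Fin n) (Fin n) 𝕜}
    (hX : X.IsHermitian) {κ : Type*} [Fintype κ] [DecidableEq κ] {V : Matrix (Fin n) κ 𝕜}
    (hV : Vᴴ * V = 1) {d : κ → ℝ} (hP : P = V * (diagonal fun i => (d i : 𝕜)) * Vᴴ) :
    ∫ U, deviation z (unitaryConj U X) P ^ 2 ∂(haarUnitary n 𝕜)
      ≤ (144 * (∑ i, d i ^ 2) ^ 2 / n) ^ 2 := by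
  set N := traceless (transformMatrix X z)
  have hN := integral_frobSq_compression_sq_le
    (isHermitian_traceless (isHermitian_transformMatrix hX z)) (trace_traceless _) hV hP
  have hF : 0 ≤ frobSq N / n := div_nonneg (frobSq_nonneg N) n.cast_nonneg
  simp only [deviation_unitaryConj_left, div_pow]
  rw [integral_div, div_le_iff₀ (by positivity)]
  refine hN.trans ?_
  rw [← div_pow, ← mul_pow, mul_div_assoc, mul_assoc, mul_assoc]
  have : frobSq N / n ^ 2 ≤ (1 + frobSq N / n) / n := by
    rw [sq, ← div_div]
    gcongr
    linarith
  have h0 : 0 ≤ frobSq N / (n : ℝ) ^ 2 := div_nonneg (frobSq_nonneg N) (by positivity)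
  calc (144 * ((∑ i, d i ^ 2) ^ 2 * (frobSq N / n ^ 2))) ^ 2
      ≤ (144 * ((∑ i, d i ^ 2) ^ 2 * ((1 + frobSq N / n) / n))) ^ 2 := by gcongr
    _ = _ := by ring

end Deviation

section Averaging

variable {𝕜 : Type*} [RCLike 𝕜] {n : ℕ} {Ω : Type*} [MeasurableSpace Ω] {Pr : Measure Ω}
  [IsProbabilityMeasure Pr] {X P : Ω → Matrix (Fin n) (Fin n) 𝕜}
  {F : Matrix (Fin n) (Fin n) 𝕜 × Matrix (Fin n) (Fin n) 𝕜 → ℝ≥0∞}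

lemma lintegral_unitaryConj_left_eq (hX : Measurable X) (hP : Measurable P)
    (hindep : IndepFun X P Pr) (hinv : IsConjInvariant Pr X ∨ IsConjInvariant Pr P)
    (hF : Measurable F) (hFconj : ∀ U A B, F (unitaryConj U A, unitaryConj U B) = F (A, B))
    (U : unitaryGroup (Fin n) 𝕜) :
    ∫⁻ ω, F (unitaryConj U (X ω), P ω) ∂Pr = ∫⁻ ω, F (X ω, P ω) ∂Pr := by
  have hconj : ∀ V, Measurable (unitaryConj V : Matrix (Fin n) (Fin n) 𝕜 → _) := fun V =>
    ((continuous_const.matrix_mul continuous_id).matrix_mul continuous_const).measurable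
  have hlaw : ∀ X' P' : Ω → Matrix (Fin n) (Fin n) 𝕜, Measurable X' → Measurable P' →
      IndepFun X' P' Pr → Measure.map X' Pr = Measure.map X Pr →
      Measure.map P' Pr = Measure.map P Pr →
      ∫⁻ ω, F (X' ω, P' ω) ∂Pr = ∫⁻ ω, F (X ω, P ω) ∂Pr := by
    intro X' P' hX' hP' hindep' hXX' hPP'
    rw [← lintegral_map hF (hX'.prodMk hP'), ← lintegral_map hF (hX.prodMk hP),
      (indepFun_iff_map_prod_eq_prod_map_map hX'.aemeasurable hP'.aemeasurable).1 hindep',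
      (indepFun_iff_map_prod_eq_prod_map_map hX.aemeasurable hP.aemeasurable).1 hindep,
      hXX', hPP']
  rcases hinv with h | h
  · exact hlaw _ _ ((hconj U).comp hX) hP (hindep.comp (hconj U) measurable_id) (h U U.2) rfl
  · have hpull : ∀ ω, F (unitaryConj U (X ω), P ω) = F (X ω, unitaryConj U⁻¹ (P ω)) := fun ω => by
      rw [← hFconj U (X ω), unitaryConj_unitaryConj_inv]
    simp only [hpull]
    exact hlaw _ _ hX ((hconj U⁻¹).comp hP) (hindep.comp measurable_id (hconj U⁻¹)) rfl
      (h _ U⁻¹.2)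

lemma lintegral_eq_lintegral_haarUnitary (hX : Measurable X) (hP : Measurable P)
    (hindep : IndepFun X P Pr) (hinv : IsConjInvariant Pr X ∨ IsConjInvariant Pr P)
    (hF : Measurable F) (hFconj : ∀ U A B, F (unitaryConj U A, unitaryConj U B) = F (A, B)) :
    ∫⁻ ω, F (X ω, P ω) ∂Pr
      = ∫⁻ ω, ∫⁻ U, F (unitaryConj U (X ω), P ω) ∂(haarUnitary n 𝕜) ∂Pr := by
  have hconj : Continuous fun q : unitaryGroup (Fin n) 𝕜 × Matrix (Fin n) (Fin n) 𝕜 =>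
      unitaryConj q.1 q.2 := by
    unfold unitaryConj
    fun_prop
  have hmeas : Measurable fun p : Ω × unitaryGroup (Fin n) 𝕜 =>
      F (unitaryConj p.2 (X p.1), P p.1) :=
    hF.comp ((hconj.measurable.comp (measurable_snd.prodMk (hX.comp measurable_fst))).prodMk
      (hP.comp measurable_fst))
  rw [lintegral_lintegral_swap hmeas.aemeasurable]
  simp [lintegral_unitaryConj_left_eq hX hP hindep hinv hF hFconj]

end Averaging

section BorelCantelli

variable {Ω : Type*} [MeasurableSpace Ω] {Pr : Measure Ω}

lemma ae_tendsto_zero_of_lintegral_sq_le {f : ℕ → Ω → ℝ} {r : ℕ} {K : ℝ}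
    (hm : ∀ n, r ≤ n → Measurable (f n))
    (hf : ∀ n, r ≤ n → ∫⁻ ω, ENNReal.ofReal (f n ω ^ 2) ∂Pr ≤ ENNReal.ofReal ((K / n) ^ 2)) :
    ∀ᵐ ω ∂Pr, Tendsto (fun n => f n ω) atTop (𝓝 0) := by
  have hmeas : ∀ n, Measurable fun ω => ENNReal.ofReal (f (n + r) ω ^ 2) := fun n =>
    ((hm (n + r) (Nat.le_add_left _ _)).pow_const 2).ennreal_ofReal
  have hsum : ∫⁻ ω, ∑' n, ENNReal.ofReal (f (n + r) ω ^ 2) ∂Pr ≠ ∞ := by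
    have hK : Summable fun n : ℕ => (K / (n + r : ℕ)) ^ 2 := by
      simp only [div_pow, div_eq_mul_inv (K ^ 2)]
      exact (summable_nat_add_iff r).2 ((Real.summable_nat_pow_inv.2 one_lt_two).mul_left _)
    rw [lintegral_tsum fun n => (hmeas n).aemeasurable]
    exact ne_top_of_le_ne_top hK.tsum_ofReal_ne_top
      (ENNReal.tsum_le_tsum fun n => hf (n + r) (Nat.le_add_left _ _))
  filter_upwards [ae_lt_top (Measurable.tsum hmeas) hsum] with ω hω
  have hsq : Tendsto (fun n => f (n + r) ω ^ 2) atTop (𝓝 0) := by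
    simpa [Function.comp_def, ENNReal.toReal_ofReal, sq_nonneg] using
      (ENNReal.tendsto_toReal ENNReal.zero_ne_top).comp
        (ENNReal.tendsto_atTop_zero_of_tsum_ne_top hω.ne)
  refine (tendsto_add_atTop_iff_nat r).1 ((tendsto_zero_iff_abs_tendsto_zero _).2 ?_)
  simpa [Function.comp_def, Real.sqrt_sq_eq_abs] using (Real.continuous_sqrt.tendsto 0).comp hsq

end BorelCantelli

section FinitePerturbation

@[to_additive sum_Icc_one_eq_sum_fin]
lemma prod_Icc_one_eq_prod_fin {M : Type*} [CommMonoid M] (f : ℕ → M) (n : ℕ) :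
    ∏ k ∈ Finset.Icc 1 n, f k = ∏ i : Fin n, f (i + 1) := by
  rw [Fin.prod_univ_eq_prod_range (fun i => f (i + 1)), Finset.range_eq_Ico,
    Finset.prod_Ico_add' f 0 n 1]
  rfl

variable {𝕜 : Type*} [RCLike 𝕜] {n r : ℕ}

lemma exists_isometry_of_charpoly {P : Matrix (Fin n) (Fin n) 𝕜} (hP : P.IsHermitian)
    (hr : r ≤ n) {d : Fin r → ℝ}
    (hchar : P.charpoly =
      Polynomial.X ^ (n - r) * ∏ i, (Polynomial.X - Polynomial.C (d i : 𝕜))) :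
    ∃ V : Matrix (Fin n) (Fin r) 𝕜, Vᴴ * V = 1 ∧ P = V * (diagonal fun i => (d i : 𝕜)) * Vᴴ := by
  obtain ⟨m, rfl⟩ := Nat.exists_eq_add_of_le hr
  have hchar' : P.charpoly = ∏ i, (Polynomial.X -
      Polynomial.C ((Fin.append d (0 : Fin m → ℝ) i : ℝ) : 𝕜)) := by
    rw [hchar, Fin.prod_univ_add]
    simp [mul_comm]
  obtain ⟨W, hW, hPW⟩ := exists_unitary_diagonal_of_charpoly_eq hP hchar'
  refine ⟨W.submatrix id (Fin.castAdd m), ?_, ?_⟩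
  · have hW' : Wᴴ * W = 1 := mem_unitaryGroup_iff'.1 hW
    rw [conjTranspose_submatrix, ← submatrix_mul _ _ _ _ _ Function.bijective_id, hW']
    exact submatrix_one _ (Fin.castAdd_injective r m)
  · ext i j
    rw [hPW, Matrix.mul_apply, Matrix.mul_apply, Fin.sum_univ_add]
    simp [mul_diagonal]

lemma exists_isHermitian_mul_self {X : Matrix (Fin n) (Fin n) 𝕜} (hX : X.PosSemidef) :
    ∃ S : Matrix (Fin n) (Fin n) 𝕜, S.IsHermitian ∧ S * S = X := by
  open scoped MatrixOrder in
  exact ⟨CFC.sqrt X, (Matrix.nonneg_iff_posSemidef.1 (CFC.sqrt_nonneg X)).isHermitian,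
    CFC.sqrt_mul_sqrt_self X hX.nonneg⟩

lemma charpoly_mul_one_add {S X : Matrix (Fin n) (Fin n) 𝕜} (hSX : S * S = X)
    (P : Matrix (Fin n) (Fin n) 𝕜) : (X * (1 + P)).charpoly = (S * (1 + P) * S).charpoly := by
  rw [← hSX, Matrix.mul_assoc, charpoly_mul_comm]

lemma charpoly_mul_one_add_eq_prod {X P : Matrix (Fin n) (Fin n) 𝕜} (hX : X.PosSemidef)
    (hP : P.IsHermitian) : (X * (1 + P)).charpoly = ∏ k ∈ Finset.Icc 1 n,
      (Polynomial.X - Polynomial.C (eigenvalueDesc (X * (1 + P)) k : 𝕜)) := by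
  obtain ⟨S, hS, hSX⟩ := exists_isHermitian_mul_self hX
  have hherm : (S * (1 + P) * S).IsHermitian := by
    simpa only [hS.eq] using isHermitian_mul_mul_conjTranspose S (isHermitian_one.add hP)
  unfold eigenvalueDesc
  rw [charpoly_mul_one_add hSX, prod_Icc_one_eq_prod_fin]
  exact charpoly_eq_prod_eigenvalueDesc hherm

variable {ι : Type*} {S X P : Matrix (Fin n) (Fin n) 𝕜} {V : Matrix (Fin n) ι 𝕜}

lemma compressedResolvent_mul (hS : S.IsHermitian) (hSX : S * S = X) (z : ℝ) :
    compressedResolvent X (S * V) z = Vᴴ * transformMatrix X z * V := by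
  have hcomm : Commute S ((z : 𝕜) • 1 - X)⁻¹ :=
    commute_smul_one_sub_inv (hSX ▸ (Commute.refl S).mul_right (.refl S)) _
  calc compressedResolvent X (S * V) z
      = Vᴴ * (S * ((z : 𝕜) • 1 - X)⁻¹) * S * V := by
        simp only [compressedResolvent, conjTranspose_mul, hS.eq, Matrix.mul_assoc]
    _ = Vᴴ * transformMatrix X z * V := by
        rw [Matrix.mul_assoc Vᴴ, Matrix.mul_assoc S, ← hcomm.eq, ← Matrix.mul_assoc S, hSX,
          transformMatrix]

lemma compressedResolvent_neg (X : Matrix (Fin n) (Fin n) 𝕜) (B : Matrix (Fin n) ι 𝕜) (z : ℝ) :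
    compressedResolvent (-X) B z = -compressedResolvent X B (-z) := by
  have hneg : (z : 𝕜) • (1 : Matrix (Fin n) (Fin n) 𝕜) - -X = -(((-z : ℝ) : 𝕜) • 1 - X) := by
    push_cast
    module
  have hinv (A : Matrix (Fin n) (Fin n) 𝕜) : (-A)⁻¹ = -A⁻¹ := by
    by_cases hA : IsUnit A.det
    · exact inv_eq_right_inv (by rw [neg_mul_neg, mul_nonsing_inv A hA])
    · have hA' : ¬IsUnit (-A).det := by rwa [← isUnit_iff_isUnit_det, IsUnit.neg_iff,
        isUnit_iff_isUnit_det]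
      rw [nonsing_inv_apply_not_isUnit _ hA, nonsing_inv_apply_not_isUnit _ hA', neg_zero]
  rw [compressedResolvent, compressedResolvent, hneg, hinv, Matrix.mul_neg, Matrix.neg_mul]

variable [Fintype ι] [DecidableEq ι] {d : ι → ℝ}

lemma eigenvalueDesc_mul_one_add (hS : S.IsHermitian) (hSX : S * S = X)
    (hP : P = V * (diagonal fun i => (d i : 𝕜)) * Vᴴ) (k : ℕ) :
    eigenvalueDesc (X * (1 + P)) k = eigenvalueDesc (finiteRankUpdate X (S * V) d) k := by
  have hupdate : finiteRankUpdate X (S * V) d = S * (1 + P) * S := by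
    simp only [finiteRankUpdate, conjTranspose_mul, hS.eq, hP, ← hSX, Matrix.mul_add,
      Matrix.add_mul, Matrix.mul_one, Matrix.mul_assoc]
  rw [hupdate, eigenvalueDesc, charpoly_mul_one_add hSX, eigenvalueDesc]

lemma finiteRankUpdate_neg (X : Matrix (Fin n) (Fin n) 𝕜) (B : Matrix (Fin n) ι 𝕜) (d : ι → ℝ) :
    finiteRankUpdate (-X) B (-d) = -finiteRankUpdate X B d := by
  have : (diagonal fun i => ((-d) i : 𝕜)) = -diagonal fun i => (d i : 𝕜) := by simp
  rw [finiteRankUpdate, finiteRankUpdate, this, Matrix.mul_neg, Matrix.neg_mul, neg_add]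

end FinitePerturbation

section AlmostSureDecay

variable {𝕜 : Type*} [RCLike 𝕜] {Ω : Type*} [MeasurableSpace Ω] {Pr : Measure Ω}
  [IsProbabilityMeasure Pr] {r : ℕ} {d : Fin r → ℝ}

lemma lintegral_deviation_sq_le {n : ℕ} {X P : Ω → Matrix (Fin n) (Fin n) 𝕜} (hX : Measurable X)
    (hP : Measurable P) (hXh : ∀ ω, (X ω).IsHermitian)
    (hPV : ∀ ω, ∃ V : Matrix (Fin n) (Fin r) 𝕜,
      Vᴴ * V = 1 ∧ P ω = V * (diagonal fun i => (d i : 𝕜)) * Vᴴ)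
    (hindep : IndepFun X P Pr) (hinv : IsConjInvariant Pr X ∨ IsConjInvariant Pr P) (z : ℝ) :
    ∫⁻ ω, ENNReal.ofReal (deviation z (X ω) (P ω) ^ 2) ∂Pr
      ≤ ENNReal.ofReal ((144 * (∑ i, d i ^ 2) ^ 2 / n) ^ 2) := by
  have havg := lintegral_eq_lintegral_haarUnitary hX hP hindep hinv
    ((measurable_deviation z).pow_const 2).ennreal_ofReal
    fun U A B => by rw [deviation_unitaryConj]
  have hhaar (ω : Ω) :
      ∫⁻ U, ENNReal.ofReal (deviation z (unitaryConj U (X ω)) (P ω) ^ 2) ∂(haarUnitary n 𝕜)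
        ≤ ENNReal.ofReal ((144 * (∑ i, d i ^ 2) ^ 2 / n) ^ 2) := by
    obtain ⟨V, hV, hPω⟩ := hPV ω
    have hcont : Continuous fun U => deviation z (unitaryConj U (X ω)) (P ω) := by
      simp only [deviation_unitaryConj_left]
      exact (continuous_frobSq.comp ((continuous_const.matrix_mul
        (continuous_unitaryConj _)).matrix_mul continuous_const)).div_const _
    have h_int : Integrable (fun U => deviation z (unitaryConj U (X ω)) (P ω) ^ 2)
        (haarUnitary n 𝕜) := integrable_haarUnitary (hcont.pow 2)
    rw [← ofReal_integral_eq_lintegral_ofReal h_int (ae_of_all _ fun U => sq_nonneg _)]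
    exact ENNReal.ofReal_le_ofReal (integral_deviation_unitaryConj_sq_le z (hXh ω) hV hPω)
  simpa [havg] using lintegral_mono (μ := Pr) hhaar

theorem ae_tendsto_deviation {X P : (n : ℕ) → Ω → Matrix (Fin n) (Fin n) 𝕜}
    (hX : ∀ n, Measurable (X n)) (hXh : ∀ n ω, (X n ω).IsHermitian)
    (hP : ∀ n, r ≤ n → Measurable (P n))
    (hPV : ∀ n, r ≤ n → ∀ ω, ∃ V : Matrix (Fin n) (Fin r) 𝕜,
      Vᴴ * V = 1 ∧ P n ω = V * (diagonal fun i => (d i : 𝕜)) * Vᴴ)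
    (hindep : ∀ n, r ≤ n → IndepFun (X n) (P n) Pr)
    (hinv : ∀ n, r ≤ n → IsConjInvariant Pr (X n) ∨ IsConjInvariant Pr (P n)) (z : ℝ) :
    ∀ᵐ ω ∂Pr, Tendsto (fun n => deviation z (X n ω) (P n ω)) atTop (𝓝 0) := by
  refine ae_tendsto_zero_of_lintegral_sq_le (r := r)
    (f := fun n ω => deviation z (X n ω) (P n ω)) (fun n hn => ?_) fun n hn =>
      lintegral_deviation_sq_le (hX n) (hP n hn) (hXh n) (hPV n hn) (hindep n hn) (hinv n hn) z
  have hcomp := (measurable_deviation z).comp ((hX n).prodMk (hP n hn))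
  exact hcomp

end AlmostSureDecay

section SpectralLimit

variable {𝕜 : Type*} [RCLike 𝕜]

lemma integral_empiricalSpectralMeasure {n : ℕ} (M : Matrix (Fin n) (Fin n) 𝕜) (f : ℝ →ᵇ ℝ) :
    ∫ t, f t ∂(empiricalSpectralMeasure M) = (∑ i : Fin n, f (eigenvalueDesc M (i + 1))) / n := by
  rw [empiricalSpectralMeasure, integral_smul_measure,
    integral_finsetSum_measure fun _ _ => f.integrable _, sum_Icc_one_eq_sum_fin]
  simp [div_eq_inv_mul]

/-- Hermitian matrices with limiting eigenvalue distribution `μ` whose extreme eigenvalues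
converge to `a` and `b`, to be thought of as the edges of the support of `μ`. -/
structure HasSpectralLimit (X : (n : ℕ) → Matrix (Fin n) (Fin n) 𝕜) (μ : Measure ℝ) (a b : ℝ) :
    Prop where
  isHermitian : ∀ n, (X n).IsHermitian
  tendsto_integral : ∀ f : ℝ →ᵇ ℝ,
    Tendsto (fun n => (∑ i : Fin n, f (eigenvalueDesc (X n) (i + 1))) / n) atTop
      (𝓝 (∫ t, f t ∂μ))
  tendsto_min : Tendsto (fun n => eigenvalueDesc (X n) n) atTop (𝓝 a)
  tendsto_max : Tendsto (fun n => eigenvalueDesc (X n) 1) atTop (𝓝 b)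

variable {X : (n : ℕ) → Matrix (Fin n) (Fin n) 𝕜} {μ : Measure ℝ} {a b : ℝ}

namespace HasSpectralLimit

lemma neg (h : HasSpectralLimit X μ a b) :
    HasSpectralLimit (fun n => -X n) (μ.map Neg.neg) (-b) (-a) where
  isHermitian n := (h.isHermitian n).neg
  tendsto_integral f := by
    have hsum (n : ℕ) : ∑ i : Fin n, f (eigenvalueDesc (-X n) (i + 1))
        = ∑ i : Fin n, f (-eigenvalueDesc (X n) (i + 1)) := by
      refine Fintype.sum_equiv Fin.revPerm _ _ fun i => ?_
      rw [eigenvalueDesc_neg (h.isHermitian n) i.2, Fin.revPerm_apply, Fin.val_rev]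
      congr 3
    rw [integral_map measurable_neg.aemeasurable f.continuous.aestronglyMeasurable]
    simp only [hsum]
    exact h.tendsto_integral (f.compContinuous ⟨Neg.neg, continuous_neg⟩)
  tendsto_min := by
    refine h.tendsto_max.neg.congr' ?_
    filter_upwards [eventually_gt_atTop 0] with n hn
    obtain ⟨m, rfl⟩ := Nat.exists_eq_add_one.2 hn
    rw [eigenvalueDesc_neg (h.isHermitian _) m.lt_add_one, Nat.add_sub_cancel_left]
  tendsto_max := by
    refine h.tendsto_min.neg.congr' ?_
    filter_upwards [eventually_gt_atTop 0] with n hn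
    rw [← zero_add 1, eigenvalueDesc_neg (h.isHermitian n) hn, Nat.sub_zero]

lemma eventually_mem_Ioo (h : HasSpectralLimit X μ a b) {α β : ℝ} (hα : α < a) (hβ : b < β) :
    ∀ᶠ n in atTop, ∀ i : Fin n, eigenvalueDesc (X n) (i + 1) ∈ Ioo α β := by
  filter_upwards [h.tendsto_min.eventually_const_lt hα, h.tendsto_max.eventually_lt_const hβ]
    with n hmin hmax i
  have : NeZero n := ⟨i.pos.ne'⟩
  have hanti := antitone_eigenvalueDesc (h.isHermitian n)
  refine ⟨hmin.trans_le ?_, ((hanti (Fin.zero_le i)).trans_eq ?_).trans_lt hmax⟩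
  · simpa only [Nat.sub_one_add_one i.pos.ne'] using hanti
      (show i ≤ ⟨n - 1, Nat.sub_lt i.pos one_pos⟩ from Nat.le_sub_one_of_lt i.2)
  · simp

lemma tendsto_sum_div (h : HasSpectralLimit X μ a b) [IsProbabilityMeasure μ]
    (hμ : ∀ᵐ t ∂μ, t ∈ Icc a b) {α β : ℝ} (hα : α < a) (hβ : b < β) {g : ℝ → ℝ}
    (hg : ContinuousOn g (Icc α β)) :
    Tendsto (fun n => (∑ i : Fin n, g (eigenvalueDesc (X n) (i + 1))) / n) atTop
      (𝓝 (∫ t, g t ∂μ)) := by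
  obtain ⟨t₀, ht₀⟩ := hμ.exists
  have hαβ : α ≤ β := by linarith [ht₀.1, ht₀.2]
  let f : ℝ →ᵇ ℝ := (BoundedContinuousFunction.mkOfCompact
    ⟨(Icc α β).domRestrict g, hg.domRestrict⟩).compContinuous ⟨projIcc α β hαβ, continuous_projIcc⟩
  have hf : ∀ t ∈ Icc α β, f t = g t := fun t ht => by
    simp [f, projIcc_of_mem hαβ ht]
  have h_int : ∫ t, f t ∂μ = ∫ t, g t ∂μ := by
    refine integral_congr_ae ?_
    filter_upwards [hμ] with t ht using hf t ⟨hα.le.trans ht.1, ht.2.trans hβ.le⟩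
  refine (h_int ▸ h.tendsto_integral f).congr' ?_
  filter_upwards [h.eventually_mem_Ioo hα hβ] with n hn
  rw [Finset.sum_congr rfl fun i _ => hf _ (Ioo_subset_Icc_self (hn i))]

lemma eventually_lt_eigenvalueDesc (h : HasSpectralLimit X μ a b) [IsFiniteMeasure μ] {c : ℝ}
    (hc : 0 < μ (Ioi c)) (k : ℕ) : ∀ᶠ n in atTop, c < eigenvalueDesc (X n) (k + 1) := by
  let f : ℝ →ᵇ ℝ := BoundedContinuousFunction.ofNormedAddCommGroup
    (fun t => min 1 (max 0 (t - c))) (by fun_prop) 1 fun t => by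
      rw [Real.norm_of_nonneg (le_min zero_le_one (le_max_left _ _))]
      exact min_le_left _ _
  have hf0 (t : ℝ) : 0 ≤ f t := le_min zero_le_one (le_max_left _ _)
  have hf1 (t : ℝ) : f t ≤ 1 := min_le_left _ _
  have hf_pos (t : ℝ) : 0 < f t ↔ c < t := by simp [f]
  have h_int : 0 < ∫ t, f t ∂μ := by
    rw [integral_pos_iff_support_of_nonneg hf0 (f.integrable μ)]
    exact hc.trans_le (measure_mono fun t ht => ((hf_pos t).2 ht).ne')
  have hkn : Tendsto (fun n : ℕ => (k : ℝ) / n) atTop (𝓝 0) :=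
    tendsto_const_div_atTop_nhds_zero_nat _
  filter_upwards [(h.tendsto_integral f).eventually_const_lt (half_lt_self h_int),
    hkn.eventually_lt_const (half_pos h_int), eventually_gt_atTop k] with n hlow hup hn
  by_contra! hle
  have hterm (i : Fin n) : f (eigenvalueDesc (X n) (i + 1)) ≤ if i < k then 1 else 0 := by
    split_ifs with hi
    · exact hf1 _
    · refine not_lt.1 fun hpos => ((hf_pos _).1 hpos).not_ge (le_trans ?_ hle)
      exact antitone_eigenvalueDesc (h.isHermitian n) (show (⟨k, hn⟩ : Fin n) ≤ i from not_lt.1 hi)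
  have hsum : ∑ i : Fin n, f (eigenvalueDesc (X n) (i + 1)) ≤ k := by
    refine (Finset.sum_le_sum fun i _ => hterm i).trans_eq ?_
    rw [Finset.sum_boole, Fin.card_filter_val_lt, min_eq_right hn.le]
  exact absurd (hlow.trans_le (div_le_div_of_nonneg_right hsum n.cast_nonneg)) hup.not_gt

lemma tendsto_eigenvalueDesc_succ (h : HasSpectralLimit X μ a b) [IsFiniteMeasure μ]
    (hb : ∀ c < b, 0 < μ (Ioi c)) (k : ℕ) :
    Tendsto (fun n => eigenvalueDesc (X n) (k + 1)) atTop (𝓝 b) := by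
  refine tendsto_order.2 ⟨fun c hc => h.eventually_lt_eigenvalueDesc (hb c hc) k, fun c hc => ?_⟩
  filter_upwards [h.eventually_mem_Ioo (sub_one_lt a) hc, eventually_gt_atTop k] with n hn hkn
  exact (hn ⟨k, hkn⟩).2

end HasSpectralLimit

lemma measure_Ioi_pos_of_isLUB_support (hb : IsLUB μ.support b) {c : ℝ} (hc : c < b) :
    0 < μ (Ioi c) := by
  obtain ⟨t, ht, hct⟩ := (lt_isLUB_iff hb).1 hc
  exact (Measure.mem_support_iff_forall t).1 ht _ (Ioi_mem_nhds hct)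

lemma measure_Iio_pos_of_isGLB_support (ha : IsGLB μ.support a) {c : ℝ} (hc : a < c) :
    0 < μ (Iio c) := by
  obtain ⟨t, ht, hct⟩ := (isGLB_lt_iff ha).1 hc
  exact (Measure.mem_support_iff_forall t).1 ht _ (Iio_mem_nhds hct)

end SpectralLimit

section TransformLimit

variable {𝕜 : Type*} [RCLike 𝕜] {n : ℕ}

lemma frobSq_traceless_le (A : Matrix (Fin n) (Fin n) 𝕜) : frobSq (traceless A) ≤ frobSq A := by
  set c := A.trace / n
  set B := traceless A
  have hA : A = B + c • 1 := by simp [B, c, traceless]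
  have hB : B.trace = 0 := trace_traceless A
  have htrace : (Aᴴ * A).trace = (Bᴴ * B).trace + (star c * c) * n := by
    rw [hA]
    simp [Matrix.add_mul, Matrix.mul_add, hB, conjTranspose_smul]
    ring
  rw [frobSq_eq_re_trace, frobSq_eq_re_trace, htrace, map_add, RCLike.star_def, RCLike.conj_mul]
  have hre : RCLike.re ((‖c‖ : 𝕜) ^ 2 * n) = ‖c‖ ^ 2 * n := by norm_cast
  rw [hre]
  exact le_add_of_nonneg_right (by positivity)

lemma transformMatrix_diagonal {d : Fin n → ℝ} {z : ℝ} (hd : ∀ i, d i ≠ z) :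
    transformMatrix (diagonal fun i => (d i : 𝕜)) z
      = diagonal fun i => ((d i / (z - d i) : ℝ) : 𝕜) := by
  have hinv : ((z : 𝕜) • (1 : Matrix (Fin n) (Fin n) 𝕜) - diagonal fun i => (d i : 𝕜))⁻¹
      = diagonal fun i => (((z - d i)⁻¹ : ℝ) : 𝕜) := by
    refine inv_eq_right_inv ?_
    rw [smul_one_eq_diagonal, diagonal_sub, diagonal_mul_diagonal, ← diagonal_one]
    congr 1
    ext i
    rw [← RCLike.ofReal_sub, ← RCLike.ofReal_mul, mul_inv_cancel₀ (sub_ne_zero.2 (hd i).symm),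
      RCLike.ofReal_one]
  rw [transformMatrix, hinv, diagonal_mul_diagonal]
  simp only [← RCLike.ofReal_mul, div_eq_mul_inv]

variable {X : Matrix (Fin n) (Fin n) 𝕜}

lemma exists_unitaryConj_transformMatrix (hX : X.IsHermitian) {z : ℝ}
    (hz : ∀ i : Fin n, eigenvalueDesc X (i + 1) ≠ z) :
    ∃ W : unitaryGroup (Fin n) 𝕜, transformMatrix X z = unitaryConj W (diagonal fun i : Fin n =>
      ((eigenvalueDesc X (i + 1) / (z - eigenvalueDesc X (i + 1)) : ℝ) : 𝕜)) := by
  obtain ⟨W, hW, hXW⟩ := exists_unitary_eigenvalueDesc hX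
  refine ⟨⟨W, hW⟩, ?_⟩
  rw [← transformMatrix_diagonal hz, ← transformMatrix_unitaryConj]
  exact congrArg (transformMatrix · z) hXW

lemma trace_transformMatrix (hX : X.IsHermitian) {z : ℝ}
    (hz : ∀ i : Fin n, eigenvalueDesc X (i + 1) ≠ z) :
    (transformMatrix X z).trace
      = ((∑ i : Fin n, eigenvalueDesc X (i + 1) / (z - eigenvalueDesc X (i + 1)) : ℝ) : 𝕜) := by
  obtain ⟨W, hW⟩ := exists_unitaryConj_transformMatrix hX hz
  rw [hW, trace_unitaryConj, trace_diagonal, RCLike.ofReal_sum]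

lemma frobSq_transformMatrix (hX : X.IsHermitian) {z : ℝ}
    (hz : ∀ i : Fin n, eigenvalueDesc X (i + 1) ≠ z) :
    frobSq (transformMatrix X z)
      = ∑ i : Fin n, (eigenvalueDesc X (i + 1) / (z - eigenvalueDesc X (i + 1))) ^ 2 := by
  obtain ⟨W, hW⟩ := exists_unitaryConj_transformMatrix hX hz
  rw [hW, frobSq_unitaryConj, frobSq]
  simp only [diagonal_apply, apply_ite norm, RCLike.norm_ofReal, norm_zero, ite_pow, sq_abs,
    zero_pow two_ne_zero, Finset.sum_ite_eq, Finset.mem_univ, if_true]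

end TransformLimit

section CompressedTransform

variable {𝕜 : Type*} [RCLike 𝕜] {X : (n : ℕ) → Matrix (Fin n) (Fin n) 𝕜} {μ : Measure ℝ}
  {a b z : ℝ}

lemma exists_notMem_Icc_enlarged (hz : z ∉ Icc a b) : ∃ α < a, ∃ β > b, z ∉ Icc α β := by
  rcases lt_or_ge z a with hza | haz
  · obtain ⟨α, hzα, hα⟩ := exists_between hza
    exact ⟨α, hα, b + 1, lt_add_one b, fun h => h.1.not_gt hzα⟩
  · obtain ⟨β, hβ, hzβ⟩ := exists_between (not_le.1 fun hzb => hz ⟨haz, hzb⟩)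
    exact ⟨a - 1, sub_one_lt a, β, hβ, fun h => h.2.not_gt hzβ⟩

namespace HasSpectralLimit

lemma eventually_ne (h : HasSpectralLimit X μ a b) (hz : z ∉ Icc a b) :
    ∀ᶠ n in atTop, ∀ i : Fin n, eigenvalueDesc (X n) (i + 1) ≠ z := by
  obtain ⟨α, hα, β, hβ, hz⟩ := exists_notMem_Icc_enlarged hz
  filter_upwards [h.eventually_mem_Ioo hα hβ] with n hn i hi
  exact hz (Ioo_subset_Icc_self (hi ▸ hn i))

variable [IsProbabilityMeasure μ]

lemma tendsto_sum_div_sub (h : HasSpectralLimit X μ a b) (hμ : ∀ᵐ t ∂μ, t ∈ Icc a b)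
    (hz : z ∉ Icc a b) (p : ℕ) :
    Tendsto (fun n => (∑ i : Fin n,
      (eigenvalueDesc (X n) (i + 1) / (z - eigenvalueDesc (X n) (i + 1))) ^ p) / n) atTop
      (𝓝 (∫ t, (t / (z - t)) ^ p ∂μ)) := by
  obtain ⟨α, hα, β, hβ, hz⟩ := exists_notMem_Icc_enlarged hz
  refine h.tendsto_sum_div hμ hα hβ (g := fun t => (t / (z - t)) ^ p) ?_
  have hne : ∀ t ∈ Icc α β, z - t ≠ 0 := fun t ht => sub_ne_zero.2 fun hzt => hz (hzt ▸ ht)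
  fun_prop (disch := assumption)

lemma tendsto_trace_transformMatrix_div (h : HasSpectralLimit X μ a b)
    (hμ : ∀ᵐ t ∂μ, t ∈ Icc a b) (hz : z ∉ Icc a b) :
    Tendsto (fun n => (transformMatrix (X n) z).trace / n) atTop (𝓝 (Ttransform μ z : 𝕜)) := by
  have hlim := h.tendsto_sum_div_sub hμ hz 1
  simp only [pow_one] at hlim
  refine ((RCLike.continuous_ofReal.tendsto _).comp hlim).congr' ?_
  filter_upwards [h.eventually_ne hz] with n hn
  rw [trace_transformMatrix (h.isHermitian n) hn, Function.comp_apply, RCLike.ofReal_div,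
    RCLike.ofReal_natCast]

lemma tendsto_frobSq_transformMatrix_div (h : HasSpectralLimit X μ a b)
    (hμ : ∀ᵐ t ∂μ, t ∈ Icc a b) (hz : z ∉ Icc a b) :
    Tendsto (fun n => frobSq (transformMatrix (X n) z) / n) atTop
      (𝓝 (∫ t, (t / (z - t)) ^ 2 ∂μ)) := by
  refine (h.tendsto_sum_div_sub hμ hz 2).congr' ?_
  filter_upwards [h.eventually_ne hz] with n hn
  rw [frobSq_transformMatrix (h.isHermitian n) hn]

variable {P : (n : ℕ) → Matrix (Fin n) (Fin n) 𝕜}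

lemma tendsto_frobSq_mul_traceless_mul (h : HasSpectralLimit X μ a b)
    (hμ : ∀ᵐ t ∂μ, t ∈ Icc a b) (hz : z ∉ Icc a b)
    (hdev : Tendsto (fun n => deviation z (X n) (P n)) atTop (𝓝 0)) :
    Tendsto (fun n => frobSq (P n * traceless (transformMatrix (X n) z) * P n)) atTop (𝓝 0) := by
  have hbound : Tendsto (fun n => deviation z (X n) (P n) *
      (1 + frobSq (transformMatrix (X n) z) / n)) atTop (𝓝 0) := by
    simpa only [zero_mul] using
      hdev.mul ((h.tendsto_frobSq_transformMatrix_div hμ hz).const_add 1)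
  refine squeeze_zero (fun n => frobSq_nonneg _) (fun n => ?_) hbound
  have hpos : 0 < 1 + frobSq (traceless (transformMatrix (X n) z)) / n :=
    add_pos_of_pos_of_nonneg one_pos (div_nonneg (frobSq_nonneg _) n.cast_nonneg)
  calc frobSq (P n * traceless (transformMatrix (X n) z) * P n)
      = deviation z (X n) (P n) * (1 + frobSq (traceless (transformMatrix (X n) z)) / n) :=
        (div_mul_cancel₀ _ hpos.ne').symm
    _ ≤ _ := by
        gcongr
        · exact div_nonneg (frobSq_nonneg _) hpos.le
        · exact frobSq_traceless_le _

variable {κ : Type*} [Fintype κ] [DecidableEq κ] {d : κ → ℝ} {V : (n : ℕ) → Matrix (Fin n) κ 𝕜}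

lemma tendsto_compression_traceless (h : HasSpectralLimit X μ a b)
    (hμ : ∀ᵐ t ∂μ, t ∈ Icc a b) (hz : z ∉ Icc a b) (hd : ∀ i, d i ≠ 0)
    (hV : ∀ᶠ n in atTop,
      (V n)ᴴ * V n = 1 ∧ P n = V n * (diagonal fun i => (d i : 𝕜)) * (V n)ᴴ)
    (hdev : Tendsto (fun n => deviation z (X n) (P n)) atTop (𝓝 0)) :
    Tendsto (fun n => (V n)ᴴ * traceless (transformMatrix (X n) z) * V n) atTop (𝓝 0) := by
  set C := fun n => (V n)ᴴ * traceless (transformMatrix (X n) z) * V n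
  have hsum : Tendsto (fun n => ∑ i, ∑ j, d i ^ 2 * d j ^ 2 * ‖C n i j‖ ^ 2) atTop (𝓝 0) := by
    refine (h.tendsto_frobSq_mul_traceless_mul hμ hz hdev).congr' ?_
    filter_upwards [hV] with n ⟨hVV, hPV⟩
    rw [hPV, frobSq_compression hVV]
  refine tendsto_pi_nhds.2 fun i => tendsto_pi_nhds.2 fun j => ?_
  have hdd : 0 < d i ^ 2 * d j ^ 2 :=
    mul_pos (pow_two_pos_of_ne_zero (hd i)) (pow_two_pos_of_ne_zero (hd j))
  have hentry : Tendsto (fun n => d i ^ 2 * d j ^ 2 * ‖C n i j‖ ^ 2) atTop (𝓝 0) := by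
    refine squeeze_zero (fun n => by positivity) (fun n => ?_) hsum
    have hnonneg (k l : κ) : 0 ≤ d k ^ 2 * d l ^ 2 * ‖C n k l‖ ^ 2 := by positivity
    exact (Finset.single_le_sum (fun l _ => hnonneg i l) (Finset.mem_univ j)).trans
      (Finset.single_le_sum (f := fun k => ∑ l, d k ^ 2 * d l ^ 2 * ‖C n k l‖ ^ 2)
        (fun k _ => Finset.sum_nonneg fun l _ => hnonneg k l) (Finset.mem_univ i))
  have hsq := hentry.const_mul (d i ^ 2 * d j ^ 2)⁻¹
  simp only [inv_mul_cancel_left₀ hdd.ne', mul_zero] at hsq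
  have hnorm := (Real.continuous_sqrt.tendsto 0).comp hsq
  simp only [Function.comp_def, Real.sqrt_sq (norm_nonneg _), Real.sqrt_zero] at hnorm
  exact tendsto_zero_iff_norm_tendsto_zero.2 hnorm

lemma tendsto_compression_transformMatrix (h : HasSpectralLimit X μ a b)
    (hμ : ∀ᵐ t ∂μ, t ∈ Icc a b) (hz : z ∉ Icc a b) (hd : ∀ i, d i ≠ 0)
    (hV : ∀ᶠ n in atTop,
      (V n)ᴴ * V n = 1 ∧ P n = V n * (diagonal fun i => (d i : 𝕜)) * (V n)ᴴ)
    (hdev : Tendsto (fun n => deviation z (X n) (P n)) atTop (𝓝 0)) :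
    Tendsto (fun n => (V n)ᴴ * transformMatrix (X n) z * V n) atTop
      (𝓝 ((Ttransform μ z : 𝕜) • 1)) := by
  have hlim := (h.tendsto_compression_traceless hμ hz hd hV hdev).add
    ((h.tendsto_trace_transformMatrix_div hμ hz).smul_const (1 : Matrix κ κ 𝕜))
  rw [zero_add] at hlim
  refine hlim.congr' ?_
  filter_upwards [hV] with n ⟨hVV, _⟩
  rw [traceless, Matrix.mul_sub, Matrix.sub_mul, Matrix.mul_smul, Matrix.mul_one,
    Matrix.smul_mul, hVV, sub_add_cancel]

end HasSpectralLimit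

end CompressedTransform

section SpikedLimit

variable {𝕜 : Type*} [RCLike 𝕜] {r : ℕ} {F : ℝ → ℝ} {μ : Measure ℝ} {a b : ℝ} {d : Fin r → ℝ}
  {X Y P : (n : ℕ) → Matrix (Fin n) (Fin n) 𝕜} {B : (n : ℕ) → Matrix (Fin n) (Fin r) 𝕜}

/-- Hermitian matrices `X n` whose largest eigenvalues tend to `b`, and whose resolvents, compressed
by `B n`, tend to the scalar matrix `F` at the points to the right of `b`. -/
structure HasResolventLimit (X : (n : ℕ) → Matrix (Fin n) (Fin n) 𝕜)
    (B : (n : ℕ) → Matrix (Fin n) (Fin r) 𝕜) (F : ℝ → ℝ) (b : ℝ) : Prop where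
  isHermitian : ∀ n, (X n).IsHermitian
  tendsto_eigenvalueDesc : ∀ k, Tendsto (fun n => eigenvalueDesc (X n) (k + 1)) atTop (𝓝 b)
  tendsto_compressedResolvent : ∀ q : ℚ, b < q →
    Tendsto (fun n => compressedResolvent (X n) (B n) q) atTop (𝓝 ((F q : 𝕜) • 1))

lemma card_subtype_le_of_injective {α : Type*} {p : α → Prop} [Fintype {i // p i}] {f : α → ℕ}
    (hf : Function.Injective f) {m : ℕ} (h : ∀ i, p i → f i < m) :
    Fintype.card {i // p i} ≤ m := by
  simpa using Fintype.card_le_of_injective (fun i : {i // p i} => (⟨f i, h i i.2⟩ : Fin m))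
    fun i j hij => Subtype.ext (hf (Fin.mk.inj hij))

namespace HasResolventLimit

lemma tendsto_edge (h : HasResolventLimit X B F b) (e : Equiv.Perm (Fin r)) {k : ℕ}
    (hd : ∀ i : Fin r, k ≤ i → d (e i) ≤ 0) :
    Tendsto (fun n => eigenvalueDesc (finiteRankUpdate (X n) (B n) d) (k + 1)) atTop (𝓝 b) := by
  refine tendsto_eigenvalueDesc_finiteRankUpdate (c := 0) h.isHermitian h.tendsto_eigenvalueDesc
    h.tendsto_compressedResolvent le_rfl le_rfl (fun q hq => absurd (hq.1.trans hq.2) (lt_irrefl b))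
    (fun q _ => by simp) ?_ fun h0 => absurd h0 (lt_irrefl 0)
  refine card_subtype_le_of_injective (Fin.val_injective.comp e.symm.injective) fun i hi => ?_
  by_contra! hki
  exact hi.not_ge (by simpa using hd (e.symm i) hki)

lemma tendsto_level (h : HasResolventLimit X B F b) (hF : DecaysOnIoi F b)
    {e : Equiv.Perm (Fin r)} (hd : Antitone (d ∘ e)) {k : Fin r} (hk : 0 < d (e k)) {ℓ : ℝ}
    (hℓ : IsLevelPoint F b (1 / d (e k)) ℓ) :
    Tendsto (fun n => eigenvalueDesc (finiteRankUpdate (X n) (B n) d) (k + 1)) atTop (𝓝 ℓ) := by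
  refine tendsto_eigenvalueDesc_finiteRankUpdate h.isHermitian h.tendsto_eigenvalueDesc
    h.tendsto_compressedResolvent hk.le hℓ.le (fun q hq => (div_lt_iff₀' hk).1 (hℓ.lt_apply hF hq))
    (fun q hq => (lt_div_iff₀' hk).1 (hℓ.apply_lt hF hq)) ?_ fun _ => ?_
  · refine card_subtype_le_of_injective (Fin.val_injective.comp e.symm.injective) fun i hi => ?_
    exact hd.reflect_lt (by simpa using hi)
  · let f (i : Fin (k + 1)) : {i // d (e k) ≤ d i} :=
      ⟨e (i.castLE k.2), hd (Nat.le_of_lt_succ i.2)⟩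
    have hf : Function.Injective f := fun i j hij =>
      Fin.castLE_injective k.2 (e.injective (Subtype.mk.inj hij))
    simpa using Fintype.card_le_of_injective f hf

end HasResolventLimit

/-- Matrices `Y n` with the eigenvalues of `X n + B n * diagonal d * (B n)ᴴ`, where the compressed
resolvents have the T-transform of `μ` as their limit on both sides of `[a, b]`; the left side is
encoded by the reflection `X n ↦ -X n`. -/
structure HasSpikedLimit (Y X : (n : ℕ) → Matrix (Fin n) (Fin n) 𝕜)
    (B : (n : ℕ) → Matrix (Fin n) (Fin r) 𝕜) (d : Fin r → ℝ) (μ : Measure ℝ) (a b : ℝ) :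
    Prop where
  eigenvalueDesc_eq : ∀ᶠ n in atTop, ∀ k,
    eigenvalueDesc (Y n) k = eigenvalueDesc (finiteRankUpdate (X n) (B n) d) k
  right : HasResolventLimit X B (Ttransform μ) b
  left : HasResolventLimit (fun n => -X n) B (fun z => -Ttransform μ (-z)) (-a)

namespace HasSpikedLimit

lemma tendsto_right_edge (h : HasSpikedLimit Y X B d μ a b) {k : ℕ}
    (hd : ∀ i : Fin r, k ≤ i → d i ≤ 0) :
    Tendsto (fun n => eigenvalueDesc (Y n) (k + 1)) atTop (𝓝 b) := by
  refine (h.right.tendsto_edge (Equiv.refl _) hd).congr' ?_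
  filter_upwards [h.eigenvalueDesc_eq] with n hn using (hn _).symm

lemma tendsto_TinvRight (h : HasSpikedLimit Y X B d μ a b)
    (hT : DecaysOnIoi (Ttransform μ) b) (hd : Antitone d) {k : Fin r} (hk : 0 < d k) :
    Tendsto (fun n => eigenvalueDesc (Y n) (k + 1)) atTop
      (𝓝 (if (d k : EReal) > 1 / TtransformRight μ b then TinvRight μ b (1 / d k) else b)) := by
  refine (h.right.tendsto_level hT (e := Equiv.refl _) hd hk
    (isLevelPoint_TinvRight hT hk)).congr' ?_
  filter_upwards [h.eigenvalueDesc_eq] with n hn using (hn _).symm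

lemma tendsto_of_neg (h : HasSpikedLimit Y X B d μ a b) {j : ℕ} {ℓ : ℝ}
    (hℓ : Tendsto (fun n => eigenvalueDesc (finiteRankUpdate (-X n) (B n) (-d)) (j + 1)) atTop
      (𝓝 (-ℓ))) :
    Tendsto (fun n => eigenvalueDesc (Y n) (n - j)) atTop (𝓝 ℓ) := by
  rw [← neg_neg ℓ]
  refine hℓ.neg.congr' ?_
  filter_upwards [h.eigenvalueDesc_eq, eventually_gt_atTop j] with n hn hj
  rw [hn, finiteRankUpdate_neg,
    eigenvalueDesc_neg (isHermitian_finiteRankUpdate (h.right.isHermitian n)) hj, neg_neg]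

lemma tendsto_left_edge (h : HasSpikedLimit Y X B d μ a b) {j : ℕ}
    (hd : ∀ i : Fin r, j ≤ i → 0 ≤ d i.rev) :
    Tendsto (fun n => eigenvalueDesc (Y n) (n - j)) atTop (𝓝 a) :=
  h.tendsto_of_neg (h.left.tendsto_edge Fin.revPerm fun i hi => neg_nonpos.2 (hd i hi))

lemma tendsto_TinvLeft (h : HasSpikedLimit Y X B d μ a b)
    (hT : DecaysOnIoi (fun z => -Ttransform μ (-z)) (-a)) (hd : Antitone d) {j : Fin r}
    (hj : d j.rev < 0) :
    Tendsto (fun n => eigenvalueDesc (Y n) (n - j)) atTop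
      (𝓝 (if (d j.rev : EReal) < 1 / TtransformLeft μ a then TinvLeft μ a (1 / d j.rev)
        else a)) :=
  h.tendsto_of_neg (h.left.tendsto_level hT (e := Fin.revPerm)
    (d := -d) (fun _ _ hij => neg_le_neg (hd (Fin.rev_le_rev.2 hij))) (neg_pos.2 hj)
    (isLevelPoint_TinvLeft hT hj))

end HasSpikedLimit

lemma HasSpectralLimit.exists_hasSpikedLimit [IsProbabilityMeasure μ]
    (h : HasSpectralLimit X μ a b) (hX : ∀ n, (X n).PosSemidef) (ha : IsGLB μ.support a)
    (hb : IsLUB μ.support b) (hd : ∀ i, d i ≠ 0)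
    (hP : ∀ n, r ≤ n → ∃ V : Matrix (Fin n) (Fin r) 𝕜,
      Vᴴ * V = 1 ∧ P n = V * (diagonal fun i => (d i : 𝕜)) * Vᴴ)
    (hdev : ∀ q : ℚ, Tendsto (fun n => deviation (q : ℝ) (X n) (P n)) atTop (𝓝 0)) :
    ∃ B, HasSpikedLimit (fun n => X n * (1 + P n)) X B d μ a b := by
  choose S hS hSX using fun n => exists_isHermitian_mul_self (hX n)
  choose! V hV using hP
  have hV' := (eventually_ge_atTop r).mono hV
  have hμ := ae_mem_Icc_of_support ha hb
  have hres (q : ℚ) (hq : (q : ℝ) ∉ Icc a b) :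
      Tendsto (fun n => compressedResolvent (X n) (S n * V n) q) atTop
        (𝓝 ((Ttransform μ q : 𝕜) • 1)) := by
    simp only [compressedResolvent_mul (hS _) (hSX _)]
    exact h.tendsto_compression_transformMatrix hμ hq hd hV' (hdev q)
  have hleft (c : ℝ) (hc : c < -a) : 0 < μ.map Neg.neg (Ioi c) := by
    rw [Measure.map_apply measurable_neg measurableSet_Ioi, Set.neg_preimage, Set.neg_Ioi]
    exact measure_Iio_pos_of_isGLB_support ha (lt_neg_of_lt_neg hc)
  have : IsProbabilityMeasure (μ.map Neg.neg) :=
    Measure.isProbabilityMeasure_map measurable_neg.aemeasurable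
  refine ⟨fun n => S n * V n, ?_, ⟨h.isHermitian, ?_, fun q hq => ?_⟩,
    ⟨h.neg.isHermitian, h.neg.tendsto_eigenvalueDesc_succ hleft, fun q hq => ?_⟩⟩
  · exact hV'.mono fun n hn => eigenvalueDesc_mul_one_add (hS n) (hSX n) hn.2
  · exact h.tendsto_eigenvalueDesc_succ fun c => measure_Ioi_pos_of_isLUB_support hb
  · exact hres q fun hqab => hqab.2.not_gt hq
  · have hneg := (hres (-q) fun hqab => (neg_lt.1 hq).not_ge (by simpa using hqab.1)).neg
    simpa only [compressedResolvent_neg, Rat.cast_neg, RCLike.ofReal_neg, neg_smul] using hneg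

lemma nonneg_of_tendsto_eigenvalueDesc (hX : ∀ n, (X n).PosSemidef)
    (ha : Tendsto (fun n => eigenvalueDesc (X n) n) atTop (𝓝 a)) : 0 ≤ a := by
  refine ge_of_tendsto ha ?_
  filter_upwards [eventually_gt_atTop 0] with n hn
  simpa only [Nat.sub_one_add_one hn.ne'] using
    eigenvalueDesc_nonneg (hX n) ⟨n - 1, Nat.sub_lt hn one_pos⟩

theorem ae_exists_hasSpikedLimit {Ω : Type*} [MeasurableSpace Ω] {Pr : Measure Ω}
    [IsProbabilityMeasure Pr] [IsProbabilityMeasure μ]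
    {X P : (n : ℕ) → Ω → Matrix (Fin n) (Fin n) 𝕜} (hXmeas : ∀ n, Measurable (X n))
    (hXpos : ∀ n ω, (X n ω).PosSemidef)
    (ha : IsGLB μ.support a) (hb : IsLUB μ.support b)
    (hXlim : ∀ᵐ ω ∂Pr, ConvergesWeakly (fun n => empiricalSpectralMeasure (X n ω)) μ)
    (hXmin : ∀ᵐ ω ∂Pr, Tendsto (fun n => eigenvalueDesc (X n ω) n) atTop (𝓝 a))
    (hXmax : ∀ᵐ ω ∂Pr, Tendsto (fun n => eigenvalueDesc (X n ω) 1) atTop (𝓝 b))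
    (hd : ∀ i, d i ≠ 0) (hPmeas : ∀ n, r ≤ n → Measurable (P n))
    (hPherm : ∀ n, r ≤ n → ∀ ω, (P n ω).IsHermitian)
    (hPspec : ∀ n, r ≤ n → ∀ ω, (P n ω).charpoly =
      Polynomial.X ^ (n - r) * ∏ i, (Polynomial.X - Polynomial.C (d i : 𝕜)))
    (hindep : ∀ n, r ≤ n → IndepFun (X n) (P n) Pr)
    (hinv : ∀ n, r ≤ n → IsConjInvariant Pr (X n) ∨ IsConjInvariant Pr (P n)) :
    ∀ᵐ ω ∂Pr, ∃ B, HasSpikedLimit (fun n => X n ω * (1 + P n ω)) (fun n => X n ω) B d μ a b := by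
  have hPV (n : ℕ) (hn : r ≤ n) (ω : Ω) :=
    exists_isometry_of_charpoly (hPherm n hn ω) hn (hPspec n hn ω)
  have hdev : ∀ᵐ ω ∂Pr, ∀ q : ℚ,
      Tendsto (fun n => deviation (q : ℝ) (X n ω) (P n ω)) atTop (𝓝 0) :=
    ae_all_iff.2 fun q => ae_tendsto_deviation hXmeas (fun n ω => (hXpos n ω).isHermitian) hPmeas
      hPV hindep hinv q
  filter_upwards [hXlim, hXmin, hXmax, hdev] with ω hlim hmin hmax hdev
  have hspec : HasSpectralLimit (fun n => X n ω) μ a b :=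
    ⟨fun n => (hXpos n ω).isHermitian,
      by simpa only [ConvergesWeakly, integral_empiricalSpectralMeasure] using hlim, hmin, hmax⟩
  exact hspec.exists_hasSpikedLimit (fun n => hXpos n ω) ha hb hd (fun n hn => hPV n hn ω) hdev

end SpikedLimit

end SpikedMatrix

end

theorem theorem2p6 {𝕜 : Type*} [RCLike 𝕜]
    {Ω : Type*} [MeasurableSpace Ω] (Pr : Measure Ω) [IsProbabilityMeasure Pr]
    -- the random matrices `X_n`, nonnegative definite
    (X : (n : ℕ) → Ω → Matrix (Fin n) (Fin n) 𝕜)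
    (hXmeas : ∀ n, Measurable (X n))
    (hXpos : ∀ n ω, (X n ω).PosSemidef)
    -- the limiting eigenvalue distribution and the edges of its support
    (μX : Measure ℝ) [IsProbabilityMeasure μX] (hμcompact : IsCompact μX.support)
    (hμne : μX ≠ Measure.dirac 0)
    (a b : ℝ) (ha : IsGLB μX.support a) (hb : IsLUB μX.support b)
    (hXlim : ∀ᵐ ω ∂Pr,
      SpikedMatrix.ConvergesWeakly (fun n => SpikedMatrix.empiricalSpectralMeasure (X n ω)) μX)
    (hXmin : ∀ᵐ ω ∂Pr, Tendsto (fun n => SpikedMatrix.eigenvalueDesc (X n ω) n) atTop (𝓝 a))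
    (hXmax : ∀ᵐ ω ∂Pr, Tendsto (fun n => SpikedMatrix.eigenvalueDesc (X n ω) 1) atTop (𝓝 b))
    -- the numbers `θ_1 ≥ ⋯ ≥ θ_s > 0 > θ_{s+1} ≥ ⋯ ≥ θ_r`
    (r s : ℕ) (hr : 1 ≤ r) (hsr : s ≤ r) (θ : ℕ → ℝ)
    (hθanti : AntitoneOn θ (Set.Icc 1 r))
    (hθpos : ∀ i ∈ Set.Icc 1 s, 0 < θ i)
    (hθneg : ∀ i ∈ Set.Icc (s + 1) r, θ i < 0)
    -- the random Hermitian matrices `P_n`, with nonzero eigenvalues `θ_1, …, θ_r`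
    (P : (n : ℕ) → Ω → Matrix (Fin n) (Fin n) 𝕜)
    (hPmeas : ∀ n, r ≤ n → Measurable (P n))
    (hPherm : ∀ n, r ≤ n → ∀ ω, (P n ω).IsHermitian)
    (hPspec : ∀ n, r ≤ n → ∀ ω, (P n ω).charpoly =
      Polynomial.X ^ (n - r) * ∏ i ∈ Finset.Icc 1 r, (Polynomial.X - Polynomial.C (θ i : 𝕜)))
    -- independence, and invariance of one of the two
    (hindep : ∀ n, r ≤ n → IndepFun (X n) (P n) Pr)
    (hinv : ∀ n, r ≤ n →
      SpikedMatrix.IsConjInvariant Pr (X n) ∨ SpikedMatrix.IsConjInvariant Pr (P n)) :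
    -- the eigenvalues of `X_n (I_n + P_n)` are real
    (∀ n, r ≤ n → ∀ ω, (X n ω * (1 + P n ω)).charpoly = ∏ k ∈ Finset.Icc 1 n,
      (Polynomial.X -
        Polynomial.C (SpikedMatrix.eigenvalueDesc (X n ω * (1 + P n ω)) k : 𝕜))) ∧
    -- `T_μ` is a bijection from `(b, ∞)` onto `(0, T_μ(b^+))`
    -- and from `(-∞, a)` onto `(T_μ(a^-), 0)`
    Set.BijOn (SpikedMatrix.Ttransform μX) (Set.Ioi b)
      {y : ℝ | 0 < y ∧ (y : EReal) < SpikedMatrix.TtransformRight μX b} ∧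
    Set.BijOn (SpikedMatrix.Ttransform μX) (Set.Iio a)
      {y : ℝ | SpikedMatrix.TtransformLeft μX a < (y : EReal) ∧ y < 0} ∧
    -- the largest eigenvalues
    (∀ i, 1 ≤ i → i ≤ s → ∀ᵐ ω ∂Pr,
      Tendsto (fun n => SpikedMatrix.eigenvalueDesc (X n ω * (1 + P n ω)) i) atTop
        (𝓝 (if (θ i : EReal) > 1 / SpikedMatrix.TtransformRight μX b
            then SpikedMatrix.TinvRight μX b (1 / θ i) else b))) ∧
    (∀ i, s < i → ∀ᵐ ω ∂Pr,
      Tendsto (fun n => SpikedMatrix.eigenvalueDesc (X n ω * (1 + P n ω)) i) atTop (𝓝 b)) ∧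
    -- the smallest eigenvalues
    (∀ j, j < r - s → ∀ᵐ ω ∂Pr,
      Tendsto (fun n => SpikedMatrix.eigenvalueDesc (X n ω * (1 + P n ω)) (n - j)) atTop
        (𝓝 (if (θ (r - j) : EReal) < 1 / SpikedMatrix.TtransformLeft μX a
            then SpikedMatrix.TinvLeft μX a (1 / θ (r - j)) else a))) ∧
    (∀ j, r - s ≤ j → ∀ᵐ ω ∂Pr,
      Tendsto (fun n => SpikedMatrix.eigenvalueDesc (X n ω * (1 + P n ω)) (n - j)) atTop
        (𝓝 a)) := by
  have ha0 : 0 ≤ a := by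
    obtain ⟨ω, hω⟩ := hXmin.exists
    exact SpikedMatrix.nonneg_of_tendsto_eigenvalueDesc (fun n => hXpos n ω) hω
  have hab := SpikedMatrix.ae_mem_Icc_of_support ha hb
  have hTb := SpikedMatrix.decaysOnIoi_Ttransform ha0 hab hμne
  have hTa := SpikedMatrix.decaysOnIoi_neg_Ttransform_neg ha0 hab hμne
  let d : Fin r → ℝ := fun i => θ (i + 1)
  have hdanti : Antitone d := fun i j hij => hθanti ⟨by lia, by lia⟩ ⟨by lia, by lia⟩
    (Nat.succ_le_succ hij)
  have hdpos (i : Fin r) (hi : i < s) : 0 < d i := hθpos _ ⟨by lia, by lia⟩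
  have hdneg (i : Fin r) (hi : s ≤ i) : d i < 0 := hθneg _ ⟨by lia, by lia⟩
  have hlim := SpikedMatrix.ae_exists_hasSpikedLimit (d := d) hXmeas hXpos ha hb hXlim hXmin hXmax
    (fun i => (lt_or_ge (i : ℕ) s).elim (fun hi => (hdpos i hi).ne') fun hi => (hdneg i hi).ne)
    hPmeas hPherm (by simpa only [SpikedMatrix.prod_Icc_one_eq_prod_fin] using hPspec) hindep hinv
  refine ⟨fun n hn ω => SpikedMatrix.charpoly_mul_one_add_eq_prod (hXpos n ω) (hPherm n hn ω),
    SpikedMatrix.bijOn_Ttransform_Ioi hTb, SpikedMatrix.bijOn_Ttransform_Iio hTa,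
    fun i hi his => ?_, fun i hi => ?_, fun j hj => ?_, fun j hj => ?_⟩ <;>
    filter_upwards [hlim] with ω ⟨B, hB⟩
  · obtain ⟨k, rfl⟩ := Nat.exists_eq_add_one.2 hi
    exact hB.tendsto_TinvRight hTb hdanti (hdpos ⟨k, by lia⟩ his)
  · obtain ⟨k, rfl⟩ := Nat.exists_eq_add_one.2 (pos_of_gt hi)
    exact hB.tendsto_right_edge fun i hki => (hdneg i (by lia)).le
  · have hrev : r - (j + 1) + 1 = r - j := by lia
    simpa only [d, Fin.val_rev, hrev] using
      hB.tendsto_TinvLeft hTa hdanti (j := ⟨j, by lia⟩) (hdneg _ (by simp only [Fin.val_rev]; lia))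
  · exact hB.tendsto_left_edge fun i hji => (hdpos _ (by simp only [Fin.val_rev]; lia)).le
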